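/- Let $N\ge 2$ and $1\le k\le N-1$ be integers, $\zeta_N=e^{2\pi i/N}$, and for $\operatorname{Im} y>0$ put $q=e^{2\pi i y}$ and $$f_{k,N}(y)=\log(\zeta_N^k;q)_\infty=\sum_{n\ge 0}\log(1-\zeta_N^k q^n),\qquad g_{k,N}(y)=\log(q^k;q^N)_\infty=\sum_{n\ge 0}\log(1-q^{k+nN}),$$ with principal logarithms. Let $\tilde f_{k,N}$ be the formal Laurent series $$\tilde f_{k,N}(y)=\tfrac12\log(1-\zeta_N^k)+\frac{\mathrm{Li}_2(\zeta_N^k)}{2\pi i y}+\psi_k(y),\qquad \psi_k(y)=\sum_{n\ge 1}(2\pi i y)^{2n-1}\frac{B_{2n}}{(2n)!}\,\mathrm{Li}_{2-2n}(\zeta_N^k),$$ which is the series of the asymptotic expansion of $f_{k,N}(y)$ as $y\to0$ with $\operatorname{Im}y>0$; here $B_{2n}$ are the Bernoulli numbers and $\mathrm{Li}_{-m}(x)=(x\,d/dx)^m\frac{x}{1-x}$ for $m\ge0$. For a formal series $\phi(y)=\sum_{j=0}^{J} c_j y^{-j}+\sum_{n\ge0}a_n y^{n+1}$ whose Borel transform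 $\sum_{n\ge 0} \frac{a_n}{n!}\zeta^n$ converges near $0$ and continues analytically, with at most exponential growth, to an open sector around the ray $e^{i\theta}\mathbb R_{\ge0}$, the continuation being denoted $\mathcal B[\phi]$, its Borel–Laplace sum at angle $\theta$ is $$s_\theta(\phi)(y)=\sum_{j=0}^{J} c_j y^{-j}+\int_{e^{i\theta}\mathbb R_{\ge0}}e^{-\zeta/y}\,\mathcal B[\phi](\zeta)\,d\zeta ,\qquad \operatorname{Re}(e^{-i\theta}y)>0,$$ wherever the integral converges absolutely. Its median resummation at angle $\theta$ is $\mathcal S^{\rm med}_\theta\phi(y)=\frac12\big(s_{\theta+\epsilon}(\phi)(y)+s_{\theta-\epsilon}(\phi)(y)\big)$, where the lateral sums $s_{\theta\pm\epsilon}(\phi)(y)$ are required to exist and to be independent of $\epsilon$ for all sufficiently small $\epsilon>0$ (depending on $y$). Then, for $\operatorname{Im}y>0$, the following sums exist and $$s_0(\tilde f_{k,N})(y)=f_{k,N}(y)-g_{N-k,N}\!\big(-\tfrac1{Ny}\big)\quad(\operatorname{Re}y>0),$$ $$s_\pi(\tilde f_{k,N})(y)=f_{k,N}(y)-g_{k,N}\!\big(-\tfrac1{Ny}\big)\quad(\operatorname{Re}y<0),$$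 $$\mathcal S^{\rm med}_{\pi/2}\tilde f_{k,N}(y)=f_{k,N}(y)-\tfrac12\Big[g_{k,N}\!\big(-\tfrac1{Ny}\big)+g_{N-k,N}\!\big(-\tfrac1{Ny}\big)\Big]\quad(\text{all }y\text{ with }\operatorname{Im}y>0).$$ In particular the median resummation does not recover $f_{k,N}$: there is $y$ with $\operatorname{Im}y>0$ at which $\mathcal S^{\rm med}_{\pi/2}\tilde f_{k,N}(y)\neq f_{k,N}(y)$. -/

import Mathlib

open Complex Set Filter Topology MeasureTheory

noncomputable section

/-! ### The q-Pochhammer symbol and its logarithm -/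

/-- The infinite q-Pochhammer symbol `(x; q)_∞ = ∏_{n ≥ 0} (1 - x q^n)`. -/
def qPochhammerInf (x q : ℂ) : ℂ := ∏' n : ℕ, (1 - x * q ^ n)

/-- The holomorphic branch `log (x; q)_∞ = ∑_{n ≥ 0} log (1 - x q^n)` (principal logarithms),
which for `|x| ≤ 1`, `x ≠ 1`, `|q| < 1` is the one given by the Taylor series of the logarithm. -/
def logQPochhammerInf (x q : ℂ) : ℂ := ∑' n : ℕ, Complex.log (1 - x * q ^ n)

/-- The series defining `log (x; q)_∞` converges for `|q| < 1`, and when no factor vanishes it is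
a logarithm of `(x; q)_∞`. -/
theorem logQPochhammerInf_spec (x q : ℂ) (hq : ‖q‖ < 1) :
    (Summable fun n : ℕ => Complex.log (1 - x * q ^ n)) ∧
      ((∀ n : ℕ, x * q ^ n ≠ 1) →
        Complex.exp (logQPochhammerInf x q) = qPochhammerInf x q) := by
  have hs : Summable fun n : ℕ => Complex.log (1 - x * q ^ n) := by
    have h0 : Summable fun n : ℕ => -(x * q ^ n) :=
      ((summable_geometric_of_norm_lt_one hq).mul_left x).neg
    simpa [sub_eq_add_neg] using Complex.summable_log_one_add_of_summable h0
  refine ⟨hs, fun hx => ?_⟩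
  exact Complex.cexp_tsum_eq_tprod (fun n => sub_ne_zero.mpr (hx n).symm) hs

/-- `ζ_N = e^{2πi/N}`. -/
def zetaN (N : ℕ) : ℂ := Complex.exp (2 * Real.pi * I / N)

/-- `f_{k,N}(y) = log (ζ_N^k; q)_∞`, `q = e^{2πiy}`, for `Im y > 0`. -/
def fkN (k N : ℕ) (y : ℂ) : ℂ :=
  logQPochhammerInf (zetaN N ^ k) (Complex.exp (2 * Real.pi * I * y))

/-- `g_{k,N}(y) = log (q^k; q^N)_∞`, `q = e^{2πiy}`, for `Im y > 0`. -/
def gkN (k N : ℕ) (y : ℂ) : ℂ :=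
  logQPochhammerInf (Complex.exp (2 * Real.pi * I * y) ^ k)
    (Complex.exp (2 * Real.pi * I * y) ^ N)

/-! ### Polylogarithms and the formal expansion -/

/-- The dilogarithm `Li_2(x) = ∑_{n ≥ 1} x^n / n^2` on the closed unit disc. -/
def dilog (x : ℂ) : ℂ := ∑' n : ℕ, x ^ (n + 1) / ((n : ℂ) + 1) ^ 2

/-- The polylogarithm of non-positive order, `Li_{-m}(x) = (x d/dx)^m (x / (1 - x))`. -/
def polylogNeg (m : ℕ) : ℂ → ℂ :=
  (fun (h : ℂ → ℂ) (x : ℂ) => x * deriv h x)^[m] (fun x : ℂ => x / (1 - x))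

/-- `ψ_k(y) = ∑_{n ≥ 1} (2πiy)^{2n-1} B_{2n} / (2n)! Li_{2-2n}(ζ_N^k)`; here `j = 2n - 1`. -/
def psiSeries (k N : ℕ) : PowerSeries ℂ :=
  PowerSeries.mk fun j : ℕ =>
    if Odd j then
      (2 * Real.pi * I) ^ j * ((bernoulli (j + 1) : ℚ) : ℂ) / ((j + 1).factorial : ℂ) *
        polylogNeg (j - 1) (zetaN N ^ k)
    else 0

/-- The formal series
`f̃_{k,N}(y) = (1/2) log (1 - ζ_N^k) + Li_2(ζ_N^k) / (2πiy) + ψ_k(y)`,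
as a formal Laurent series in `y`. -/
def fTilde (k N : ℕ) : LaurentSeries ℂ :=
  HahnSeries.single (0 : ℤ) (1 / 2 * Complex.log (1 - zetaN N ^ k)) +
    HahnSeries.single (-1 : ℤ) (dilog (zetaN N ^ k) / (2 * Real.pi * I)) +
    (psiSeries k N : LaurentSeries ℂ)

/-! ### Borel--Laplace sums -/

/-- Coefficients of the Borel transform `∑_{n ≥ 0} (a_n / n!) ζ^n` of the part
`∑_{n ≥ 0} a_n y^{n+1}` of positive order of the formal Laurent series `φ`. -/
def borelCoeff (φ : LaurentSeries ℂ) (n : ℕ) : ℂ :=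
  φ.coeff ((n : ℤ) + 1) / (n.factorial : ℂ)

/-- The open sector of half-opening `δ` around the ray of angle `θ` (vertex excluded). -/
def openSector (θ δ : ℝ) : Set ℂ :=
  {ζ : ℂ | ζ ≠ 0 ∧ |Complex.arg (Complex.exp (-(θ * I)) * ζ)| < δ}

/-- `B` is an analytic continuation of the Borel transform of `φ` from a neighbourhood of the
origin (where that series converges) to an open sector around the ray of angle `θ`, of at most
exponential growth there. -/
def IsBorelContinuation (φ : LaurentSeries ℂ) (θ : ℝ) (B : ℂ → ℂ) : Prop :=
  HasFPowerSeriesAt B (FormalMultilinearSeries.ofScalars ℂ (borelCoeff φ)) 0 ∧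
    ∃ δ > 0, AnalyticOnNhd ℂ B (openSector θ δ) ∧
      ∃ C K : ℝ, ∀ ζ ∈ openSector θ δ, ‖B ζ‖ ≤ C * Real.exp (K * ‖ζ‖)

/-- The integrand of `∫_{C_θ} e^{-ζ/y} B(ζ) dζ` in the parametrisation `ζ = t e^{iθ}`, `t > 0`. -/
def laplaceIntegrand (B : ℂ → ℂ) (θ : ℝ) (y : ℂ) (t : ℝ) : ℂ :=
  Complex.exp (-(t * Complex.exp (θ * I)) / y) * B (t * Complex.exp (θ * I)) *
    Complex.exp (θ * I)

/-- `φ` is Borel--Laplace summable at angle `θ` at the point `y` of the half-plane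
`Re (e^{-iθ} y) > 0`, and its Borel--Laplace sum `s_θ(φ)(y)` equals `s`. The finitely many terms of
non-positive order are evaluated at `y`; the terms of positive order are replaced by the Laplace
transform of their Borel transform along the ray of angle `θ`. -/
def HasBorelLaplaceSum (φ : LaurentSeries ℂ) (θ : ℝ) (y s : ℂ) : Prop :=
  0 < (Complex.exp (-(θ * I)) * y).re ∧
    ∃ B : ℂ → ℂ, IsBorelContinuation φ θ B ∧
      IntegrableOn (laplaceIntegrand B θ y) (Ioi 0) ∧
      s = (∑ᶠ n : {n : ℤ // n ≤ 0}, φ.coeff n * y ^ (n : ℤ)) +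
        ∫ t in Ioi (0 : ℝ), laplaceIntegrand B θ y t

/-- The median resummation of `φ` at angle `θ` exists at `y` and equals `m`: the average
`(s_{θ₊}(φ)(y) + s_{θ₋}(φ)(y)) / 2` of the lateral sums, where `θ_± = θ ± ε` for all small
`ε > 0`. -/
def HasMedianSum (φ : LaurentSeries ℂ) (θ : ℝ) (y m : ℂ) : Prop :=
  ∃ sp sm : ℂ,
    (∀ᶠ ε : ℝ in 𝓝[>] 0, HasBorelLaplaceSum φ (θ + ε) y sp) ∧
    (∀ᶠ ε : ℝ in 𝓝[>] 0, HasBorelLaplaceSum φ (θ - ε) y sm) ∧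
    m = (sp + sm) / 2

/-- The Borel--Laplace sum is well defined. -/
theorem HasBorelLaplaceSum.unique {φ : LaurentSeries ℂ} {θ : ℝ} {y s s' : ℂ}
    (h : HasBorelLaplaceSum φ θ y s) (h' : HasBorelLaplaceSum φ θ y s') : s = s' := by
  obtain ⟨-, B, ⟨hB0, δ, hδ, hB, -⟩, -, rfl⟩ := h
  obtain ⟨-, B', ⟨hB0', δ', hδ', hB', -⟩, -, rfl⟩ := h'
  have key : ∀ (δ : ℝ), 0 < δ → ∀ t : ℝ, 0 < t →
      (t : ℂ) * Complex.exp (θ * I) ∈ openSector θ δ := by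
    intro δ hδ t ht
    refine ⟨mul_ne_zero (by exact_mod_cast ht.ne') (Complex.exp_ne_zero _), ?_⟩
    have : Complex.exp (-(θ * I)) * ((t : ℂ) * Complex.exp (θ * I)) = (t : ℂ) := by
      rw [mul_left_comm, ← Complex.exp_add]; simp
    rw [this, Complex.arg_ofReal_of_nonneg ht.le]
    simpa using hδ
  set L : ℝ → ℂ := fun t => (t : ℂ) * Complex.exp (θ * I) with hL
  have hpre : IsPreconnected (L '' Ici 0) :=
    (isPreconnected_Ici).image L (by fun_prop)
  have mk : ∀ (B : ℂ → ℂ) (δ : ℝ), 0 < δ → AnalyticAt ℂ B 0 →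
      AnalyticOnNhd ℂ B (openSector θ δ) → AnalyticOnNhd ℂ B (L '' Ici 0) := by
    rintro B δ hδ h0 hB _ ⟨t, ht, rfl⟩
    rcases (mem_Ici.mp ht).eq_or_lt with rfl | ht'
    · simpa [hL] using h0
    · exact hB _ (key δ hδ t ht')
  have heq : EqOn B B' (L '' Ici 0) := by
    refine (mk B δ hδ hB0.analyticAt hB).eqOn_of_preconnected_of_eventuallyEq
      (mk B' δ' hδ' hB0'.analyticAt hB') hpre (z₀ := 0) ⟨0, self_mem_Ici, by simp [hL]⟩ ?_
    have h1 := hB0.sub hB0'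
    rw [sub_self] at h1
    filter_upwards [h1.eventually_eq_zero] with z hz
    exact sub_eq_zero.mp hz
  congr 1
  refine setIntegral_congr_fun measurableSet_Ioi fun t ht => ?_
  have := heq ⟨t, (mem_Ioi.mp ht).le, rfl⟩
  simp only [hL] at this
  simp only [laplaceIntegrand, this]

/-- The median resummation is well defined. -/
theorem HasMedianSum.unique {φ : LaurentSeries ℂ} {θ : ℝ} {y m m' : ℂ}
    (h : HasMedianSum φ θ y m) (h' : HasMedianSum φ θ y m') : m = m' := by
  obtain ⟨a, b, ha, hb, rfl⟩ := h
  obtain ⟨a', b', ha', hb', rfl⟩ := h'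
  obtain ⟨ε, h1, h2⟩ := (ha.and ha').exists
  obtain ⟨ε', h3, h4⟩ := (hb.and hb').exists
  rw [h1.unique h2, h3.unique h4]

end

open Complex Set Filter Topology MeasureTheory

noncomputable section

/-! Put ω = ζ_N^k and L(ω, z) = ∑_{m ≥ 1} ω^m / (m + z). Since Li_0(ω e^u) has Taylor coefficients
Li_{-n}(ω) / n! and Euler's formula turns B_{2n} / (2n)! into ζ(2n), the Borel transform of ψ_k is
an explicit sum over j ≥ 1 of the even part of u ↦ Li_0(ω e^u) at ξ / j, weighted by 1 / j²
(`borelSum`, `hasFPowerSeriesAt_borelSum`). Its singularities lie on the imaginary axis, away from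
0, and it is bounded on every double cone |Im ξ| < κ |Re ξ|. Hence it is Laplace summable along
every non-vertical ray.

The reflection Li_0(x) = -1 - Li_0(1/x) makes every exponential decay along the ray. The Laplace
integral then becomes i/(2π) times the sum over j of (1/j) (-y/j + L(ω, j/y) - L(ω⁻¹, j/y))
(`laplace_borelSum`). On the other side, the Lambert series of log (ω; q)_∞ and the partial
fractions of the cotangent show that f minus its two leading terms is i/(2π) times the sum of (1/j)
(L(ω, j/y) - L(ω, -j/y)) (`hasSum_fkN_sub`).

In the difference of the two, L(ω, j/y) cancels. What remains, 1/z + L(ω⁻¹, z) - L(ω, -z) at z =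
j/y, is a bilateral sum twisted by roots of unity. It is elementary
(`one_div_add_blockLim_sub_blockLim`), and summing it over j gives the Lambert series of
g_{N-k}(-1/(Ny)). For rays in the left half-plane, evenness of the Borel transform reduces the
Laplace integral at y to the one at -y, which exchanges ω and ω⁻¹, hence k and N - k.

The two lateral sums at π/2 are therefore the right and left sums, and the median is their average.
At y = i both g-terms have negative real part, so they cannot cancel. -/

/-- `Li_0 (ω e^u)`, the generating function of the polylogarithms of non-positive order. -/
def polylogGen (ω u : ℂ) : ℂ := ω * exp u / (1 - ω * exp u)

/-! ### Bounds for Li_0(ω e^u) away from the imaginary axis. -/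

/-- The double cone `|Im u| < κ |Re u|` around the real axis. -/
def realCone (κ : ℝ) : Set ℂ := {u | |u.im| < κ * |u.re|}

theorem isOpen_realCone (κ : ℝ) : IsOpen (realCone κ) :=
  isOpen_lt (by fun_prop) (by fun_prop)

theorem neg_mem_realCone {κ : ℝ} {u : ℂ} (hu : u ∈ realCone κ) : -u ∈ realCone κ := by
  simpa [realCone] using hu

theorem ofReal_mul_mem_realCone {κ t : ℝ} (ht : 0 < t) {u : ℂ} (hu : u ∈ realCone κ) :
    (t : ℂ) * u ∈ realCone κ := by
  simp only [realCone, mem_ofPred_eq, re_ofReal_mul, im_ofReal_mul, abs_mul, abs_of_pos ht] at hu ⊢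
  nlinarith

theorem exists_mem_realCone {c : ℂ} (hc : c.re ≠ 0) : ∃ κ > 0, c ∈ realCone κ := by
  have h : 0 < |c.re| := abs_pos.mpr hc
  refine ⟨|c.im| / |c.re| + 1, by positivity, ?_⟩
  rw [realCone, mem_ofPred_eq, add_mul, div_mul_cancel₀ _ h.ne']
  linarith

theorem exists_ball_le_norm_one_sub_mul_exp {ω : ℂ} (hω : ω ≠ 1) :
    ∃ ρ > 0, ∃ η > 0, ∀ u : ℂ, ‖u‖ < ρ → η ≤ ‖1 - ω * exp u‖ := by
  have h1 : 0 < ‖1 - ω‖ := norm_pos_iff.mpr (sub_ne_zero.mpr hω.symm)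
  have hc : ContinuousAt (fun u : ℂ => ‖1 - ω * exp u‖) 0 := by fun_prop
  have h2 : ∀ᶠ u in 𝓝 (0 : ℂ), ‖1 - ω‖ / 2 < ‖1 - ω * exp u‖ :=
    hc.eventually (lt_mem_nhds (by simpa using h1))
  obtain ⟨ρ, hρ, h⟩ := Metric.eventually_nhds_iff.mp h2
  exact ⟨ρ, hρ, ‖1 - ω‖ / 2, by positivity, fun u hu => (h (by simpa using hu)).le⟩

/-- Near 0 the value is close to 1 - ω ≠ 0. Elsewhere in the cone |Re u| is bounded below, so |ω
e^u| = e^{Re u} stays away from 1. No upper bound on κ is needed, so any non-vertical ray is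
covered. -/
theorem exists_realCone_le_norm_one_sub_mul_exp {ω : ℂ} (hω : ω ≠ 1) (hω1 : ‖ω‖ = 1) {κ : ℝ}
    (hκ : 0 < κ) : ∃ η > 0, ∀ u ∈ realCone κ, η ≤ ‖1 - ω * exp u‖ := by
  obtain ⟨ρ, hρ, η, hη, h⟩ := exists_ball_le_norm_one_sub_mul_exp hω
  -- In the cone ‖u‖ ≤ |Re u| + |Im u| ≤ (1 + κ) |Re u|, so |Re u| < r puts u in the ball of radius
  -- ρ.
  set r := ρ / (1 + κ) with hr
  have hr0 : 0 < r := by positivity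
  have e1 : 0 < Real.exp r - 1 := by linarith [Real.add_one_lt_exp hr0.ne']
  have e2 : 0 < 1 - Real.exp (-r) := by
    have := Real.exp_lt_exp.mpr (show -r < 0 by linarith)
    rw [Real.exp_zero] at this
    linarith
  refine ⟨min η (min (Real.exp r - 1) (1 - Real.exp (-r))), by positivity, fun u hu => ?_⟩
  have hn : ‖ω * exp u‖ = Real.exp u.re := by rw [norm_mul, hω1, one_mul, norm_exp]
  rcases lt_or_ge |u.re| r with hlt | hge
  · refine (min_le_left _ _).trans (h u ?_)
    have h1 := norm_le_abs_re_add_abs_im u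
    have h2 : |u.im| < κ * |u.re| := hu
    have h3 : r * (1 + κ) = ρ := div_mul_cancel₀ _ (by positivity)
    nlinarith
  · rcases le_abs'.mp hge with h1 | h1
    · refine (min_le_right _ _).trans ((min_le_right _ _).trans ?_)
      have := norm_sub_norm_le (1 : ℂ) (ω * exp u)
      rw [hn, norm_one] at this
      have := Real.exp_le_exp.mpr h1
      linarith
    · refine (min_le_right _ _).trans ((min_le_left _ _).trans ?_)
      have := norm_sub_norm_le (ω * exp u) (1 : ℂ)
      rw [hn, norm_one, norm_sub_rev] at this
      have := Real.exp_le_exp.mpr h1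
      linarith

theorem polylogGen_eq {ω u : ℂ} (h : 1 - ω * exp u ≠ 0) :
    polylogGen ω u = (1 - ω * exp u)⁻¹ - 1 := by
  rw [polylogGen]; field_simp; ring

theorem norm_polylogGen_le {ω u : ℂ} {η : ℝ} (hη : 0 < η) (h : η ≤ ‖1 - ω * exp u‖) :
    ‖polylogGen ω u‖ ≤ η⁻¹ + 1 := by
  have h0 : 0 < ‖1 - ω * exp u‖ := hη.trans_le h
  rw [polylogGen_eq (norm_pos_iff.mp h0)]
  refine (norm_sub_le _ _).trans ?_
  rw [norm_inv, norm_one]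
  gcongr

/-- This keeps the decay of the numerator e^u. It gives integrability along a ray even when no
further exponential factor is present, as at z = 0 below. -/
theorem norm_polylogGen_le_exp {ω u : ℂ} (hω1 : ‖ω‖ = 1) {η : ℝ} (hη : 0 < η)
    (h : η ≤ ‖1 - ω * exp u‖) : ‖polylogGen ω u‖ ≤ Real.exp u.re / η := by
  rw [polylogGen, norm_div, norm_mul, hω1, one_mul, norm_exp]
  gcongr

theorem differentiableAt_polylogGen {ω u : ℂ} (h : 1 - ω * exp u ≠ 0) :
    DifferentiableAt ℂ (polylogGen ω) u := by
  unfold polylogGen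
  exact DifferentiableAt.div (by fun_prop) (by fun_prop) h

/-- The reflection Li_0(x) = -1 - Li_0(1/x). It turns a growing exponential in the argument into a
decaying one, at the price of ω ↦ ω⁻¹. -/
theorem polylogGen_inv {ω u : ℂ} (hω : ω ≠ 0) (h : 1 - ω * exp u ≠ 0) :
    polylogGen ω u = -1 - polylogGen ω⁻¹ (-u) := by
  have he := exp_ne_zero u
  have h2 : ω * exp u - 1 ≠ 0 := by rw [← neg_sub]; exact neg_ne_zero.mpr h
  have : 1 - ω⁻¹ * (exp u)⁻¹ = (ω * exp u - 1) / (ω * exp u) := by field_simp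
  rw [polylogGen, polylogGen, exp_neg, this]
  field_simp
  rw [← neg_sub (ω * exp u) 1]
  field_simp
  ring

/-! ### The Borel transform as a sum of dilates: convergence, boundedness, analyticity. -/

/-- The Borel transform of the expansion of `log (ω; q)_∞`. -/
def borelSum (ω ξ : ℂ) : ℂ :=
  I / (2 * Real.pi) *
    ∑' j : ℕ, (polylogGen ω (ξ / (j + 1)) + polylogGen ω (-(ξ / (j + 1)))) / ((j : ℂ) + 1) ^ 2

theorem summable_one_div_succ_sq : Summable fun j : ℕ => 1 / ((j : ℝ) + 1) ^ 2 := by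
  have := (summable_nat_add_iff 1).mpr (Real.summable_one_div_nat_pow.mpr one_lt_two)
  simpa using this

theorem norm_natCast_add_one (j : ℕ) : ‖(j : ℂ) + 1‖ = (j : ℝ) + 1 := by
  exact_mod_cast Complex.norm_natCast (j + 1)

theorem natCast_add_one_ne_zero' (j : ℕ) : (j : ℂ) + 1 ≠ 0 := by exact_mod_cast j.succ_ne_zero

theorem div_natCast_mem_realCone {κ : ℝ} {ξ : ℂ} (h : ξ ∈ realCone κ) (j : ℕ) :
    ξ / ((j : ℂ) + 1) ∈ realCone κ := by
  have := ofReal_mul_mem_realCone (t := ((j : ℝ) + 1)⁻¹) (by positivity) h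
  convert this using 1
  push_cast; field_simp

section
variable {ω : ℂ} {U : Set ℂ} {C : ℝ}

/-- The bound for the terms of `borelSum`. -/
theorem norm_borelSum_term_le (hC : ∀ u ∈ U, ‖polylogGen ω u‖ ≤ C)
    (hdiv : ∀ u ∈ U, ∀ j : ℕ, u / ((j : ℂ) + 1) ∈ U) (hneg : ∀ u ∈ U, -u ∈ U) (j : ℕ) {ξ : ℂ}
    (hξ : ξ ∈ U) :
    ‖(polylogGen ω (ξ / (j + 1)) + polylogGen ω (-(ξ / (j + 1)))) / ((j : ℂ) + 1) ^ 2‖ ≤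
      2 * C * (1 / ((j : ℝ) + 1) ^ 2) := by
  rw [norm_div, norm_pow, norm_natCast_add_one, mul_one_div]
  gcongr
  refine (norm_add_le _ _).trans ?_
  have h1 := hC _ (hdiv ξ hξ j)
  have h2 := hC _ (hneg _ (hdiv ξ hξ j))
  linarith

theorem summable_borelSum (hC : ∀ u ∈ U, ‖polylogGen ω u‖ ≤ C)
    (hdiv : ∀ u ∈ U, ∀ j : ℕ, u / ((j : ℂ) + 1) ∈ U) (hneg : ∀ u ∈ U, -u ∈ U) {ξ : ℂ}
    (hξ : ξ ∈ U) :
    Summable fun j : ℕ =>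
      (polylogGen ω (ξ / (j + 1)) + polylogGen ω (-(ξ / (j + 1)))) / ((j : ℂ) + 1) ^ 2 :=
  .of_norm_bounded (summable_one_div_succ_sq.mul_left (2 * C))
    fun j => norm_borelSum_term_le hC hdiv hneg j hξ

theorem exists_norm_borelSum_le (hC : ∀ u ∈ U, ‖polylogGen ω u‖ ≤ C)
    (hdiv : ∀ u ∈ U, ∀ j : ℕ, u / ((j : ℂ) + 1) ∈ U) (hneg : ∀ u ∈ U, -u ∈ U) :
    ∃ D, ∀ ξ ∈ U, ‖borelSum ω ξ‖ ≤ D := by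
  refine ⟨‖I / (2 * Real.pi)‖ * ∑' j : ℕ, 2 * C * (1 / ((j : ℝ) + 1) ^ 2), fun ξ hξ => ?_⟩
  rw [borelSum, norm_mul]
  gcongr
  exact tsum_of_norm_bounded (summable_one_div_succ_sq.mul_left (2 * C)).hasSum
    fun j => norm_borelSum_term_le hC hdiv hneg j hξ

theorem differentiableOn_borelSum (hU : IsOpen U) (hC : ∀ u ∈ U, ‖polylogGen ω u‖ ≤ C)
    (hd : ∀ u ∈ U, 1 - ω * exp u ≠ 0)
    (hdiv : ∀ u ∈ U, ∀ j : ℕ, u / ((j : ℂ) + 1) ∈ U) (hneg : ∀ u ∈ U, -u ∈ U) :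
    DifferentiableOn ℂ (borelSum ω) U := by
  have := differentiableOn_tsum_of_summable_norm
    (F := fun (j : ℕ) ξ =>
      (polylogGen ω (ξ / (j + 1)) + polylogGen ω (-(ξ / (j + 1)))) / ((j : ℂ) + 1) ^ 2)
    (summable_one_div_succ_sq.mul_left (2 * C)) (fun j ξ hξ => ?_) hU
    fun j ξ hξ => norm_borelSum_term_le hC hdiv hneg j hξ
  · exact this.const_mul _
  · have h1 := hdiv ξ hξ j
    have e1 : DifferentiableAt ℂ (fun ξ : ℂ => polylogGen ω (ξ / (j + 1))) ξ :=
      DifferentiableAt.fun_comp' ξ (differentiableAt_polylogGen (hd _ h1)) (by fun_prop)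
    have e2 : DifferentiableAt ℂ (fun ξ : ℂ => polylogGen ω (-(ξ / (j + 1)))) ξ :=
      DifferentiableAt.fun_comp' ξ (differentiableAt_polylogGen (hd _ (hneg _ h1))) (by fun_prop)
    exact ((e1.add e2).div_const _).differentiableWithinAt

end

/-- The cosine is 1-Lipschitz, so within |cos θ| / 2 of θ it keeps more than half its absolute
value. This bounds |Re ζ| below by a multiple of ‖ζ‖. -/
theorem exists_openSector_subset_realCone {θ : ℝ} (hθ : Real.cos θ ≠ 0) :
    ∃ δ > 0, ∃ κ > 0, openSector θ δ ⊆ realCone κ := by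
  have hc : 0 < |Real.cos θ| := abs_pos.mpr hθ
  refine ⟨|Real.cos θ| / 2, by positivity, 4 / |Real.cos θ|, by positivity, ?_⟩
  rintro ζ ⟨h0, hζ⟩
  set v := exp (-(θ * I)) * ζ with hv
  have hζv : ζ = exp (θ * I) * v := by
    rw [hv, ← mul_assoc, ← exp_add]; simp
  have hn : ‖ζ‖ = ‖v‖ := by rw [hζv, norm_mul, norm_exp_ofReal_mul_I, one_mul]
  have hre : ζ.re = ‖ζ‖ * Real.cos (θ + v.arg) := by
    have : ζ = (‖v‖ : ℂ) * exp ((θ + v.arg : ℝ) * I) := by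
      conv_lhs => rw [hζv, ← norm_mul_exp_arg_mul_I v]
      push_cast
      rw [add_mul, exp_add]; ring
    rw [hn, this, re_ofReal_mul, exp_ofReal_mul_I_re]
  have h1 := Real.abs_cos_sub_cos_le θ (θ + v.arg)
  have h2 : |θ - (θ + v.arg)| = |v.arg| := by rw [sub_add_cancel_left, abs_neg]
  have h3 := abs_sub_abs_le_abs_sub (Real.cos θ) (Real.cos (θ + v.arg))
  have h4 : |Real.cos θ| / 2 < |Real.cos (θ + v.arg)| := by linarith
  have h5 : 0 < ‖ζ‖ := norm_pos_iff.mpr h0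
  rw [realCone, mem_ofPred_eq, hre, abs_mul, abs_norm]
  calc |ζ.im| ≤ ‖ζ‖ := abs_im_le_norm ζ
    _ < 4 / |Real.cos θ| * (‖ζ‖ * (|Real.cos θ| / 2)) := by
        field_simp; linarith
    _ ≤ _ := by gcongr

theorem borelSum_neg (ω ξ : ℂ) : borelSum ω (-ξ) = borelSum ω ξ := by
  simp only [borelSum, neg_div, neg_neg, add_comm]

/-! ### Taylor expansion at the origin and identification of the Borel coefficients. -/

theorem differentiableOn_polylogNeg (m : ℕ) : DifferentiableOn ℂ (polylogNeg m) {x | x ≠ 1} := by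
  induction m with
  | zero =>
    intro x hx
    have : 1 - x ≠ 0 := sub_ne_zero.mpr (Ne.symm hx)
    exact (DifferentiableAt.div (by fun_prop) (by fun_prop) this).differentiableWithinAt
  | succ m ih =>
    have h : polylogNeg (m + 1) = fun x => x * deriv (polylogNeg m) x := by
      rw [polylogNeg, Function.iterate_succ_apply']; rfl
    rw [h]
    exact differentiableOn_id.mul (ih.deriv isOpen_ne)

/-- Under x = ω e^u the derivation d/du becomes x d/dx, the operator iterated in `polylogNeg`. -/
theorem iteratedDeriv_polylogGen (ω : ℂ) (m : ℕ) {u : ℂ} (h : 1 - ω * exp u ≠ 0) :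
    iteratedDeriv m (polylogGen ω) u = polylogNeg m (ω * exp u) := by
  induction m generalizing u with
  | zero => simp [polylogGen, polylogNeg]
  | succ m ih =>
    have hopen : IsOpen {u : ℂ | 1 - ω * exp u ≠ 0} :=
      isOpen_ne_fun (by fun_prop) continuous_const
    have heq : iteratedDeriv m (polylogGen ω) =ᶠ[𝓝 u] fun v => polylogNeg m (ω * exp v) := by
      filter_upwards [hopen.mem_nhds h] with v hv using ih hv
    have hne : ω * exp u ∈ {x : ℂ | x ≠ 1} := fun h' => h (by rw [h', sub_self])
    have hd : DifferentiableAt ℂ (polylogNeg m) (ω * exp u) :=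
      (differentiableOn_polylogNeg m).differentiableAt (isOpen_ne.mem_nhds hne)
    rw [iteratedDeriv_succ, heq.deriv_eq]
    have h2 : HasDerivAt (fun v => ω * exp v) (ω * exp u) u := (hasDerivAt_exp u).const_mul ω
    have h3 : HasDerivAt (fun v => polylogNeg m (ω * exp v))
        (deriv (polylogNeg m) (ω * exp u) * (ω * exp u)) u := hd.hasDerivAt.comp u h2
    rw [h3.deriv, polylogNeg, polylogNeg, Function.iterate_succ_apply',
      mul_comm]

theorem hasSum_polylogGen {ω : ℂ} {ρ : ℝ} (h : ∀ u : ℂ, ‖u‖ < ρ → 1 - ω * exp u ≠ 0) {u : ℂ}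
    (hu : ‖u‖ < ρ) :
    HasSum (fun n : ℕ => polylogNeg n ω / n.factorial * u ^ n) (polylogGen ω u) := by
  have hd : DifferentiableOn ℂ (polylogGen ω) (Metric.ball 0 ρ) := fun v hv =>
    (differentiableAt_polylogGen (h v (by simpa using hv))).differentiableWithinAt
  have h0 : 1 - ω * exp 0 ≠ 0 := h 0 (by simpa using (norm_nonneg u).trans_lt hu)
  have := Complex.hasSum_taylorSeries_on_ball hd (z := u) (by simpa using hu)
  refine this.congr_fun fun n => ?_
  rw [iteratedDeriv_polylogGen ω n h0]
  simp only [sub_zero, exp_zero, mul_one, smul_eq_mul]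
  ring

theorem norm_one_div_succ_pow_le (j n : ℕ) :
    ‖1 / ((j : ℂ) + 1) ^ (n + 2)‖ ≤ 1 / ((j : ℝ) + 1) ^ 2 := by
  rw [norm_div, norm_one, norm_pow, norm_natCast_add_one]
  exact one_div_le_one_div_of_le (by positivity) (pow_le_pow_right₀ (by simp) (by omega))

theorem summable_one_div_succ_pow (n : ℕ) :
    Summable fun j : ℕ => 1 / ((j : ℂ) + 1) ^ (n + 2) := by
  refine .of_norm_bounded summable_one_div_succ_sq fun j => ?_
  exact norm_one_div_succ_pow_le j n

theorem norm_one_add_neg_one_pow_le (n : ℕ) : ‖(1 : ℂ) + (-1) ^ n‖ ≤ 2 := by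
  refine (norm_add_le _ _).trans ?_
  rw [norm_pow, norm_neg, norm_one, one_pow]
  norm_num

theorem summable_evenPart_dilates {c : ℕ → ℂ} {ξ : ℂ} (h : Summable fun n => c n * ξ ^ n) :
    Summable fun p : ℕ × ℕ =>
      c p.2 * (1 + (-1) ^ p.2) * ξ ^ p.2 * (1 / ((p.1 : ℂ) + 1) ^ (p.2 + 2)) := by
  refine .of_norm_bounded (summable_one_div_succ_sq.mul_of_nonneg (h.norm.mul_right 2)
    (fun _ => by positivity) (fun _ => by positivity)) fun p => ?_
  have h2 := norm_one_add_neg_one_pow_le p.2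
  have h3 := norm_one_div_succ_pow_le p.1 p.2
  calc ‖c p.2 * (1 + (-1) ^ p.2) * ξ ^ p.2 * (1 / ((p.1 : ℂ) + 1) ^ (p.2 + 2))‖
      = ‖1 / ((p.1 : ℂ) + 1) ^ (p.2 + 2)‖ * (‖c p.2 * ξ ^ p.2‖ * ‖(1 : ℂ) + (-1) ^ p.2‖) := by
        simp only [norm_mul]; ring
    _ ≤ _ := by gcongr

theorem hasSum_col_of_row {T : ℕ × ℕ → ℂ} (hT : Summable T) {a b : ℕ → ℂ}
    (ha : ∀ j, HasSum (fun n => T (j, n)) (a j)) (hb : ∀ n, HasSum (fun j => T (j, n)) (b n)) :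
    HasSum b (∑' j, a j) := by
  rw [(hT.hasSum.prod_fiberwise ha).tsum_eq]
  have h : HasSum (T ∘ Equiv.prodComm ℕ ℕ) (∑' p, T p) :=
    (Equiv.prodComm ℕ ℕ).hasSum_iff.mpr hT.hasSum
  exact h.prod_fiberwise hb

theorem hasSum_evenPart_dilate {c : ℕ → ℂ} {f : ℂ → ℂ} {ρ : ℝ}
    (h : ∀ u : ℂ, ‖u‖ < ρ → HasSum (fun n => c n * u ^ n) (f u)) {ξ : ℂ} (hξ : ‖ξ‖ < ρ) (j : ℕ) :
    HasSum (fun n => c n * (1 + (-1) ^ n) * ξ ^ n * (1 / ((j : ℂ) + 1) ^ (n + 2)))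
      ((f (ξ / (j + 1)) + f (-(ξ / (j + 1)))) / ((j : ℂ) + 1) ^ 2) := by
  have hdiv : ‖ξ / ((j : ℂ) + 1)‖ < ρ := by
    rw [norm_div, norm_natCast_add_one]
    exact (div_le_self (norm_nonneg _) (by simp)).trans_lt hξ
  have h1 := h _ hdiv
  have h2 := h (-(ξ / ((j : ℂ) + 1))) (by rw [norm_neg]; exact hdiv)
  refine ((h1.add h2).div_const (((j : ℂ) + 1) ^ 2)).congr_fun fun n => ?_
  have := natCast_add_one_ne_zero' j
  rw [neg_pow (ξ / ((j : ℂ) + 1)), div_pow, pow_add _ n 2]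
  field_simp

/-- Expand each dilate in powers of ξ and exchange the sums over j and n. The double series
converges absolutely because of the weight 1 / (j + 1)². -/
theorem hasSum_evenPart_dilates {c : ℕ → ℂ} {f : ℂ → ℂ} {ρ : ℝ}
    (h : ∀ u : ℂ, ‖u‖ < ρ → HasSum (fun n => c n * u ^ n) (f u)) {ξ : ℂ} (hξ : ‖ξ‖ < ρ) :
    HasSum (fun n : ℕ => c n * (1 + (-1) ^ n) * ξ ^ n * ∑' j : ℕ, 1 / ((j : ℂ) + 1) ^ (n + 2))
      (∑' j : ℕ, (f (ξ / (j + 1)) + f (-(ξ / (j + 1)))) / ((j : ℂ) + 1) ^ 2) := by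
  have hcol : ∀ n : ℕ, HasSum
      (fun j : ℕ => c n * (1 + (-1) ^ n) * ξ ^ n * (1 / ((j : ℂ) + 1) ^ (n + 2)))
      (c n * (1 + (-1) ^ n) * ξ ^ n * ∑' j : ℕ, 1 / ((j : ℂ) + 1) ^ (n + 2)) :=
    fun n => (summable_one_div_succ_pow n).hasSum.mul_left _
  exact hasSum_col_of_row (summable_evenPart_dilates (h ξ hξ).summable)
    (hasSum_evenPart_dilate h hξ) hcol

theorem hasSum_borelSum {ω : ℂ} {ρ : ℝ} (h : ∀ u : ℂ, ‖u‖ < ρ → 1 - ω * exp u ≠ 0) {ξ : ℂ}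
    (hξ : ‖ξ‖ < ρ) :
    HasSum (fun n : ℕ => ξ ^ n * (I / (2 * Real.pi) * (polylogNeg n ω / n.factorial *
      (1 + (-1) ^ n) * ∑' j : ℕ, 1 / ((j : ℂ) + 1) ^ (n + 2)))) (borelSum ω ξ) := by
  have := (hasSum_evenPart_dilates (fun u hu => hasSum_polylogGen h hu) hξ).mul_left
    (I / (2 * Real.pi))
  refine this.congr_fun fun n => ?_
  ring

theorem tsum_one_div_succ_pow_even (l : ℕ) :
    ∑' j : ℕ, 1 / ((j : ℂ) + 1) ^ (2 * l + 2) =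
      (-1) ^ l * 2 ^ (2 * l + 1) * (Real.pi : ℂ) ^ (2 * l + 2) *
        ((bernoulli (2 * l + 2) : ℚ) : ℂ) / ((2 * l + 2).factorial : ℂ) := by
  have h := (hasSum_nat_add_iff' 1).mpr (hasSum_zeta_nat (k := l + 1) (by omega))
  have h2 := (Complex.hasSum_ofReal.mpr h).tsum_eq
  have e : 2 * (l + 1) = 2 * l + 2 := by ring
  simp only [e, Finset.range_one, Finset.sum_singleton, show 2 * l + 2 - 1 = 2 * l + 1 by omega]
    at h2
  push_cast at h2
  rw [h2]
  simp [pow_succ]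

theorem coeff_fTilde (k N : ℕ) (n : ℕ) :
    (fTilde k N).coeff ((n : ℤ) + 1) = PowerSeries.coeff (n + 1) (psiSeries k N) := by
  have h : ((n : ℤ) + 1) = ((n + 1 : ℕ) : ℤ) := by push_cast; rfl
  rw [fTilde, HahnSeries.coeff_add, HahnSeries.coeff_add, HahnSeries.coeff_single_of_ne (by omega),
    HahnSeries.coeff_single_of_ne (by omega), h, LaurentSeries.coeff_coe_powerSeries]
  simp

/-- For even n = 2l the coefficient involves B_{2l+2} / (2l+2)!, which Euler's formula rewrites as
ζ(2l+2). For odd n both sides vanish, the right one through the factor 1 + (-1)^n. -/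
theorem borelCoeff_fTilde (k N n : ℕ) :
    borelCoeff (fTilde k N) n =
      I / (2 * Real.pi) * (polylogNeg n (zetaN N ^ k) / n.factorial *
      (1 + (-1) ^ n) * ∑' j : ℕ, 1 / ((j : ℂ) + 1) ^ (n + 2)) := by
  rw [borelCoeff, coeff_fTilde, psiSeries, PowerSeries.coeff_mk]
  rcases Nat.even_or_odd n with he | ho
  · obtain ⟨l, rfl⟩ := even_iff_two_dvd.mp he
    rw [if_pos he.add_one, tsum_one_div_succ_pow_even, he.neg_one_pow]
    have hpi : (Real.pi : ℂ) ≠ 0 := by exact_mod_cast Real.pi_ne_zero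
    have hI : (I : ℂ) ^ (2 * l + 1) = (-1) ^ l * I := by rw [pow_succ, pow_mul, I_sq]
    rw [add_tsub_cancel_right, mul_pow, hI]
    simp only [mul_pow, pow_add, Nat.add_assoc]
    norm_num
    field_simp
  · rw [if_neg (by simpa using ho.add_one), ho.neg_one_pow]
    simp

theorem hasFPowerSeriesAt_borelSum {k N : ℕ} (hω : zetaN N ^ k ≠ 1) :
    HasFPowerSeriesAt (borelSum (zetaN N ^ k))
      (FormalMultilinearSeries.ofScalars ℂ (borelCoeff (fTilde k N))) 0 := by
  obtain ⟨ρ, hρ, η, hη, h⟩ := exists_ball_le_norm_one_sub_mul_exp hω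
  rw [hasFPowerSeriesAt_iff]
  filter_upwards [Metric.ball_mem_nhds (0 : ℂ) hρ] with ξ hξ
  have := hasSum_borelSum (fun u hu => norm_pos_iff.mp (hη.trans_le (h u hu)))
    (mem_ball_zero_iff.mp hξ)
  simpa [FormalMultilinearSeries.coeff_ofScalars, borelCoeff_fTilde] using this

theorem isBorelContinuation_borelSum {k N : ℕ} (hω : zetaN N ^ k ≠ 1) (hω1 : ‖zetaN N ^ k‖ = 1)
    {θ : ℝ} (hθ : Real.cos θ ≠ 0) :
    IsBorelContinuation (fTilde k N) θ (borelSum (zetaN N ^ k)) := by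
  refine ⟨hasFPowerSeriesAt_borelSum hω, ?_⟩
  obtain ⟨δ, hδ, κ, hκ, hsub⟩ := exists_openSector_subset_realCone hθ
  obtain ⟨η, hη, h⟩ := exists_realCone_le_norm_one_sub_mul_exp hω hω1 hκ
  have hC := fun u hu => norm_polylogGen_le hη (h u hu)
  have hdiv := fun u (hu : u ∈ realCone κ) (j : ℕ) => div_natCast_mem_realCone hu j
  have hneg := fun u (hu : u ∈ realCone κ) => neg_mem_realCone hu
  obtain ⟨D, hD⟩ := exists_norm_borelSum_le hC hdiv hneg
  refine ⟨δ, hδ, ?_, D, 0, fun ζ hζ => by simpa using hD ζ (hsub hζ)⟩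
  exact ((differentiableOn_borelSum (isOpen_realCone κ) hC
    (fun u hu => norm_pos_iff.mp (hη.trans_le (h u hu))) hdiv hneg).analyticOnNhd
    (isOpen_realCone κ)).mono hsub

/-! ### The sums ∑ ω^m / (m + z) in blocks of N, and their Laplace integrals. -/

/-- The partial sum of `∑_{m ≥ 1} ω^m / (m + z)` over `n` blocks of length `N`. -/
def blockSum (N : ℕ) (ω z : ℂ) (n : ℕ) : ℂ :=
  ∑ m ∈ Finset.range (n * N), ω ^ (m + 1) / ((m : ℂ) + 1 + z)

/-- The limit of the block sums of `∑_{m ≥ 1} ω^m / (m + z)`. -/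
def blockLim (N : ℕ) (ω z : ℂ) : ℂ := limUnder atTop (blockSum N ω z)

theorem measurable_polylogGen (ω : ℂ) : Measurable (polylogGen ω) := by
  unfold polylogGen; fun_prop

theorem neg_ofReal_mul_mem_realCone {κ t : ℝ} (ht : 0 < t) {c : ℂ} (hc : c ∈ realCone κ) :
    -((t : ℂ) * c) ∈ realCone κ :=
  neg_mem_realCone (ofReal_mul_mem_realCone ht hc)

theorem exists_ray_le_norm_one_sub_mul_exp {ω : ℂ} (hω : ω ≠ 1) (hω1 : ‖ω‖ = 1) {c : ℂ}
    (hc : 0 < c.re) : ∃ η > 0, ∀ t : ℝ, 0 < t → η ≤ ‖1 - ω * exp (-(t * c))‖ := by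
  obtain ⟨κ, hκ, hcκ⟩ := exists_mem_realCone hc.ne'
  obtain ⟨η, hη, h⟩ := exists_realCone_le_norm_one_sub_mul_exp hω hω1 hκ
  exact ⟨η, hη, fun t ht => h _ (neg_ofReal_mul_mem_realCone ht hcκ)⟩

theorem integral_mul_exp_neg {a : ℂ} (ha : 0 < a.re) :
    ∫ t in Ioi (0 : ℝ), exp (-(t * a)) = a⁻¹ := by
  have := integral_exp_mul_complex_Ioi (a := -a) (by simpa using ha) 0
  simp only [ofReal_zero, mul_zero, exp_zero] at this
  rw [← neg_div_neg_eq, neg_neg, neg_neg, one_div] at this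
  rw [← this]
  congr 1 with t
  ring_nf

theorem integrableOn_exp_neg {a : ℂ} (ha : 0 < a.re) :
    IntegrableOn (fun t : ℝ => exp (-(t * a))) (Ioi 0) := by
  refine (integrableOn_exp_mul_complex_Ioi (a := -a) (by simpa using ha) 0).congr_fun
    (fun t _ => ?_) measurableSet_Ioi
  simp only [neg_mul, mul_comm a]

theorem integrableOn_real_exp_neg {a : ℝ} (ha : 0 < a) (K : ℝ) :
    IntegrableOn (fun t : ℝ => K * Real.exp (-(t * a))) (Ioi 0) := by
  refine ((integrableOn_exp_mul_Ioi (a := -a) (by simpa using ha) 0).congr_fun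
    (fun t _ => ?_) measurableSet_Ioi).const_mul K
  simp only [neg_mul, mul_comm a]

theorem integral_real_exp_neg {a : ℝ} (ha : 0 < a) (K : ℝ) :
    ∫ t in Ioi (0 : ℝ), K * Real.exp (-(t * a)) = K / a := by
  have := integral_exp_mul_Ioi (a := -a) (by simpa using ha) 0
  simp only [mul_zero, Real.exp_zero] at this
  rw [integral_const_mul, div_eq_mul_inv, ← one_div, ← neg_div_neg_eq, ← this]
  congr 2 with t
  ring_nf

theorem norm_exp_neg_ofReal_mul (t : ℝ) (a : ℂ) :
    ‖exp (-((t : ℂ) * a))‖ = Real.exp (-(t * a.re)) := by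
  rw [norm_exp, neg_re, re_ofReal_mul]

theorem sum_exp_eq {N : ℕ} {ω c : ℂ} (hωN : ω ^ N = 1) (z : ℂ) (n : ℕ) {t : ℝ}
    (h : 1 - ω * exp (-(t * c)) ≠ 0) :
    ∑ m ∈ Finset.range (n * N), c * ω ^ (m + 1) * exp (-(t * (c * ((m : ℂ) + 1 + z)))) =
      c * exp (-(t * (c * z))) * (1 - exp (-(t * c)) ^ (n * N)) *
        polylogGen ω (-(t * c)) := by
  have h1 : ω * exp (-(t * c)) ≠ 1 := fun h' => h (by rw [h', sub_self])
  have hpow : (ω * exp (-(t * c))) ^ (n * N) = exp (-(t * c)) ^ (n * N) := by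
    rw [mul_pow, mul_comm n N, pow_mul ω, hωN, one_pow, one_mul]
  have hterm : ∀ m : ℕ, c * ω ^ (m + 1) * exp (-(t * (c * ((m : ℂ) + 1 + z)))) =
      c * exp (-(t * (c * z))) * (ω * exp (-(t * c))) * (ω * exp (-(t * c))) ^ m := by
    intro m
    have : -(t * (c * ((m : ℂ) + 1 + z))) = -(t * (c * z)) + (-(t * c)) + m * (-(t * c)) := by ring
    rw [this, exp_add, exp_add, exp_nat_mul, mul_pow]
    ring
  rw [Finset.sum_congr rfl fun m _ => hterm m, ← Finset.mul_sum, geom_sum_eq h1, hpow, polylogGen,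
    ← neg_div_neg_eq (_ - _ : ℂ), neg_sub, neg_sub]
  ring

/-- Write each c / (c (m + 1 + z)) as an integral of an exponential and sum the geometric series. As
ω^N = 1, a whole number of blocks leaves the remainder e^{-tc nN}, free of ω. -/
theorem blockSum_eq_integral {N : ℕ} {ω : ℂ} (hωN : ω ^ N = 1) (hω : ω ≠ 1) (hω1 : ‖ω‖ = 1)
    {c : ℂ} (hc : 0 < c.re) {z : ℂ} (hz : 0 ≤ (c * z).re) (n : ℕ) :
    blockSum N ω z n = ∫ t in Ioi (0 : ℝ),
      c * exp (-(t * (c * z))) * (1 - exp (-(t * c)) ^ (n * N)) * polylogGen ω (-(t * c)) := by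
  obtain ⟨η, hη, h⟩ := exists_ray_le_norm_one_sub_mul_exp hω hω1 hc
  have hre : ∀ m : ℕ, 0 < (c * ((m : ℂ) + 1 + z)).re := fun m => by
    rw [mul_add, add_re, mul_comm c, ← Nat.cast_succ, ← ofReal_natCast, re_ofReal_mul]
    have : (0 : ℝ) < (m.succ : ℝ) := by positivity
    nlinarith
  rw [← setIntegral_congr_fun measurableSet_Ioi fun t ht =>
    sum_exp_eq hωN z n (norm_pos_iff.mp (hη.trans_le (h t ht))), integral_finsetSum]
  · refine Finset.sum_congr rfl fun m _ => ?_
    rw [integral_const_mul, integral_mul_exp_neg (hre m), mul_inv]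
    have : c ≠ 0 := by rintro rfl; simp at hc
    field_simp
  · exact fun m _ => (integrableOn_exp_neg (hre m)).const_mul _

theorem norm_one_sub_exp_pow_le {c : ℂ} (hc : 0 < c.re) {t : ℝ} (ht : 0 < t) (n : ℕ) :
    ‖1 - exp (-(t * c)) ^ n‖ ≤ 2 := by
  have : ‖exp (-(t * c))‖ ≤ 1 := by
    rw [norm_exp_neg_ofReal_mul]
    exact Real.exp_le_one_iff.mpr (by nlinarith)
  refine (norm_sub_le _ _).trans ?_
  rw [norm_one, norm_pow]
  linarith [pow_le_one₀ (n := n) (norm_nonneg _) this]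

/-- The block sums do not depend on c, so the integrals for all admissible c agree. This does the
work of rotating the contour. The case Re (c z) = 0 is allowed, with z = 0 in mind: the dominating
function uses only the decay of Li_0. -/
theorem tendsto_blockSum_integral {N : ℕ} (hN : 0 < N) {ω : ℂ} (hωN : ω ^ N = 1) (hω : ω ≠ 1)
    (hω1 : ‖ω‖ = 1) {c : ℂ} (hc : 0 < c.re) {z : ℂ} (hz : 0 ≤ (c * z).re) :
    Tendsto (blockSum N ω z) atTop (𝓝 (∫ t in Ioi (0 : ℝ),
      c * exp (-(t * (c * z))) * polylogGen ω (-(t * c)))) := by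
  obtain ⟨η, hη, h⟩ := exists_ray_le_norm_one_sub_mul_exp hω hω1 hc
  rw [show blockSum N ω z = _ from funext fun n => blockSum_eq_integral hωN hω hω1 hc hz n]
  refine tendsto_integral_of_dominated_convergence
    (fun t => ‖c‖ * 2 / η * Real.exp (-(t * c.re))) (fun n => ?_)
    (integrableOn_real_exp_neg hc _) (fun n => ?_) ?_
  · have := measurable_polylogGen ω
    exact Measurable.aestronglyMeasurable (by fun_prop)
  · refine (ae_restrict_iff' measurableSet_Ioi).mpr (.of_forall fun t ht => ?_)
    have ht0 : 0 < t := ht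
    have h1 := norm_one_sub_exp_pow_le hc ht0 (n * N)
    have h2 := norm_polylogGen_le_exp hω1 hη (h t ht)
    rw [neg_re, re_ofReal_mul] at h2
    have h3 : ‖exp (-(t * (c * z)))‖ ≤ 1 := by
      rw [norm_exp_neg_ofReal_mul]
      exact Real.exp_le_one_iff.mpr (by nlinarith)
    rw [norm_mul, norm_mul, norm_mul]
    calc _ ≤ ‖c‖ * 1 * 2 * (Real.exp (-(t * c.re)) / η) := by gcongr
      _ = _ := by ring
  · refine (ae_restrict_iff' measurableSet_Ioi).mpr (.of_forall fun t ht => ?_)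
    have ht0 : 0 < t := ht
    have h1 : ‖exp (-(t * c))‖ < 1 := by
      rw [norm_exp_neg_ofReal_mul]
      exact Real.exp_lt_one_iff.mpr (by nlinarith)
    have h2 : Tendsto (fun n : ℕ => exp (-(t * c)) ^ (n * N)) atTop (𝓝 0) :=
      (tendsto_pow_atTop_nhds_zero_of_norm_lt_one h1).comp
        (tendsto_id.atTop_mul_const' hN)
    have h3 := ((h2.const_sub 1).const_mul (c * exp (-(t * (c * z))))).mul_const
      (polylogGen ω (-(t * c)))
    simpa using h3

theorem blockLim_eq_integral {N : ℕ} (hN : 0 < N) {ω : ℂ} (hωN : ω ^ N = 1) (hω : ω ≠ 1)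
    (hω1 : ‖ω‖ = 1) {c : ℂ} (hc : 0 < c.re) {z : ℂ} (hz : 0 ≤ (c * z).re) :
    blockLim N ω z = ∫ t in Ioi (0 : ℝ), c * exp (-(t * (c * z))) * polylogGen ω (-(t * c)) :=
  (tendsto_blockSum_integral hN hωN hω hω1 hc hz).limUnder_eq

theorem tendsto_blockSum {N : ℕ} (hN : 0 < N) {ω : ℂ} (hωN : ω ^ N = 1) (hω : ω ≠ 1)
    (hω1 : ‖ω‖ = 1) {c : ℂ} (hc : 0 < c.re) {z : ℂ} (hz : 0 ≤ (c * z).re) :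
    Tendsto (blockSum N ω z) atTop (𝓝 (blockLim N ω z)) := by
  rw [blockLim_eq_integral hN hωN hω hω1 hc hz]
  exact tendsto_blockSum_integral hN hωN hω hω1 hc hz

/-- Uniformity in n and the decay 1 / Re (c z) matter here: for z proportional to j they supply one
of the two factors 1/j that dominate the sum over j. -/
theorem exists_norm_blockSum_le {N : ℕ} {ω : ℂ} (hωN : ω ^ N = 1) (hω : ω ≠ 1)
    (hω1 : ‖ω‖ = 1) {c : ℂ} (hc : 0 < c.re) :
    ∃ K, ∀ z : ℂ, 0 < (c * z).re → ∀ n, ‖blockSum N ω z n‖ ≤ K / (c * z).re := by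
  obtain ⟨η, hη, h⟩ := exists_ray_le_norm_one_sub_mul_exp hω hω1 hc
  refine ⟨‖c‖ * 2 * (η⁻¹ + 1), fun z hz n => ?_⟩
  rw [blockSum_eq_integral hωN hω hω1 hc hz.le, ← integral_real_exp_neg hz]
  refine norm_integral_le_of_norm_le (integrableOn_real_exp_neg hz _) ?_
  refine (ae_restrict_iff' measurableSet_Ioi).mpr (.of_forall fun t ht => ?_)
  have h1 := norm_one_sub_exp_pow_le hc ht (n * N)
  have h2 := norm_polylogGen_le hη (h t ht)
  rw [norm_mul, norm_mul, norm_mul, norm_exp_neg_ofReal_mul]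
  calc _ ≤ ‖c‖ * Real.exp (-(t * (c * z).re)) * 2 * (η⁻¹ + 1) := by gcongr
    _ = _ := by ring

/-! ### Laplace transform of the Borel transform. -/

theorem polylogGen_add_neg {ω u : ℂ} (hω : ω ≠ 0) (h : 1 - ω * exp u ≠ 0) :
    polylogGen ω u + polylogGen ω (-u) =
      -1 + polylogGen ω (-u) - polylogGen ω⁻¹ (-u) := by
  rw [polylogGen_inv hω h]; ring

theorem integrableOn_mul_polylogGen {ω : ℂ} (hω : ω ≠ 1) (hω1 : ‖ω‖ = 1) {c b : ℂ}
    (hc : 0 < c.re) (hb : 0 < b.re) :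
    IntegrableOn (fun t : ℝ => exp (-(t * b)) * polylogGen ω (-(t * c))) (Ioi 0) := by
  obtain ⟨η, hη, h⟩ := exists_ray_le_norm_one_sub_mul_exp hω hω1 hc
  refine (integrableOn_real_exp_neg hb (η⁻¹ + 1)).mono' ?_ ?_
  · have := measurable_polylogGen ω
    exact Measurable.aestronglyMeasurable (by fun_prop)
  · refine (ae_restrict_iff' measurableSet_Ioi).mpr (.of_forall fun t ht => ?_)
    rw [norm_mul, norm_exp_neg_ofReal_mul, mul_comm]
    gcongr
    exact norm_polylogGen_le hη (h t ht)

/-- After reflection the three pieces are the Laplace integrals of -1, Li_0(ω e^{-td}) and -Li_0(ω⁻¹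
e^{-td}). -/
theorem integral_borelSum_term {N : ℕ} (hN : 0 < N) {ω : ℂ} (hωN : ω ^ N = 1) (hω : ω ≠ 1)
    (hω1 : ‖ω‖ = 1) {c y : ℂ} (hc : 0 < c.re) (hy : 0 < (c / y).re) (j : ℕ) :
    ∫ t in Ioi (0 : ℝ), exp (-(t * c) / y) * ((polylogGen ω (t * c / (j + 1)) +
        polylogGen ω (-(t * c / (j + 1)))) / ((j : ℂ) + 1) ^ 2) * c =
      1 / ((j : ℂ) + 1) * (-(y / (j + 1)) + blockLim N ω ((j + 1) / y) -
        blockLim N ω⁻¹ ((j + 1) / y)) := by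
  have hj := natCast_add_one_ne_zero' j
  have hω0 : ω ≠ 0 := norm_ne_zero_iff.mp (by rw [hω1]; exact one_ne_zero)
  have hy0 : y ≠ 0 := by rintro rfl; simp at hy
  have hc0 : c ≠ 0 := by rintro rfl; simp at hc
  -- The dilation by 1 / (j + 1) is absorbed into the ray, chosen so that d · (j + 1) / y = c / y.
  set d : ℂ := c / (j + 1) with hd
  have hdre : 0 < d.re := by
    have : d = (((j : ℝ) + 1)⁻¹ : ℝ) * c := by rw [hd]; push_cast; field_simp
    rw [this, re_ofReal_mul]
    positivity
  have hdz : d * ((j + 1) / y) = c / y := by rw [hd]; field_simp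
  obtain ⟨κ, hκ, hdκ⟩ := exists_mem_realCone hdre.ne'
  obtain ⟨η, hη, h⟩ := exists_realCone_le_norm_one_sub_mul_exp hω hω1 hκ
  have hi1 : ω⁻¹ ≠ 1 := inv_ne_one.mpr hω
  have hi2 : ‖ω⁻¹‖ = 1 := by rw [norm_inv, hω1, inv_one]
  rw [blockLim_eq_integral hN hωN hω hω1 hdre (by rw [hdz]; exact hy.le),
    blockLim_eq_integral hN (by rw [inv_pow, hωN, inv_one]) hi1 hi2 hdre
      (by rw [hdz]; exact hy.le), hdz]
  simp only [mul_assoc d, integral_const_mul]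
  have e0 := integral_mul_exp_neg hy
  have i1 := integrableOn_mul_polylogGen hω hω1 hdre hy
  have i2 := integrableOn_mul_polylogGen hi1 hi2 hdre hy
  have i0 := integrableOn_exp_neg hy
  have i12 : IntegrableOn (fun t : ℝ => exp (-(t * (c / y))) * polylogGen ω (-(t * d)) -
    exp (-(t * (c / y))) * polylogGen ω⁻¹ (-(t * d))) (Ioi 0) := i1.sub i2
  have hsplit : EqOn (fun t : ℝ => exp (-(t * c) / y) * ((polylogGen ω (t * c / (j + 1)) +
        polylogGen ω (-(t * c / (j + 1)))) / ((j : ℂ) + 1) ^ 2) * c)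
      (fun t : ℝ => c / ((j : ℂ) + 1) ^ 2 * (exp (-(t * (c / y))) * polylogGen ω (-(t * d)) -
        exp (-(t * (c / y))) * polylogGen ω⁻¹ (-(t * d)) - exp (-(t * (c / y))))) (Ioi 0) := by
    intro t ht
    have ht' : (t : ℂ) * c / (j + 1) = t * d := by rw [hd]; ring
    have := h _ (ofReal_mul_mem_realCone ht hdκ)
    have hexp : -((t : ℂ) * c) / y = -(t * (c / y)) := by ring
    simp only [ht', hexp]
    rw [polylogGen_add_neg hω0 (norm_pos_iff.mp (hη.trans_le this))]
    ring
  rw [setIntegral_congr_fun measurableSet_Ioi hsplit, integral_const_mul,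
    integral_sub i12 i0, integral_sub i1 i2, e0, hd]
  field_simp
  ring

theorem laplace_borelSum {N : ℕ} (hN : 0 < N) {ω : ℂ} (hωN : ω ^ N = 1) (hω : ω ≠ 1)
    (hω1 : ‖ω‖ = 1) {c y : ℂ} (hc : 0 < c.re) (hy : 0 < (c / y).re) :
    IntegrableOn (fun t : ℝ => exp (-(t * c) / y) * borelSum ω (t * c) * c) (Ioi 0) ∧
    HasSum (fun j : ℕ => I / (2 * Real.pi) * (1 / ((j : ℂ) + 1) * (-(y / (j + 1)) +
        blockLim N ω ((j + 1) / y) - blockLim N ω⁻¹ ((j + 1) / y))))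
      (∫ t in Ioi (0 : ℝ), exp (-(t * c) / y) * borelSum ω (t * c) * c) := by
  obtain ⟨κ, hκ, hcκ⟩ := exists_mem_realCone hc.ne'
  obtain ⟨η, hη, h⟩ := exists_realCone_le_norm_one_sub_mul_exp hω hω1 hκ
  have hC := fun u hu => norm_polylogGen_le hη (h u hu)
  have hdiv := fun u (hu : u ∈ realCone κ) (j : ℕ) => div_natCast_mem_realCone hu j
  have hneg := fun u (hu : u ∈ realCone κ) => neg_mem_realCone hu
  obtain ⟨D, hD⟩ := exists_norm_borelSum_le hC hdiv hneg
  have hexp : ∀ t : ℝ, ‖exp (-(t * c) / y)‖ = Real.exp (-(t * (c / y).re)) := fun t => by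
    rw [← norm_exp_neg_ofReal_mul, neg_div, mul_div_assoc]
  have hray : ∀ t ∈ Ioi (0 : ℝ), (t : ℂ) * c ∈ realCone κ :=
    fun t ht => ofReal_mul_mem_realCone ht hcκ
  constructor
  · refine (integrableOn_real_exp_neg hy (D * ‖c‖)).mono' ?_ ?_
    · refine ContinuousOn.aestronglyMeasurable ?_ measurableSet_Ioi
      refine ContinuousOn.mul (ContinuousOn.mul (by fun_prop) ?_) continuousOn_const
      exact (differentiableOn_borelSum (isOpen_realCone κ) hC (fun u hu =>
        norm_pos_iff.mp (hη.trans_le (h u hu))) hdiv hneg).continuousOn.comp (by fun_prop) hray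
    · refine (ae_restrict_iff' measurableSet_Ioi).mpr (.of_forall fun t ht => ?_)
      rw [norm_mul, norm_mul, hexp]
      calc _ ≤ Real.exp (-(t * (c / y).re)) * D * ‖c‖ := by gcongr; exact hD _ (hray t ht)
        _ = _ := by ring
  · have hs := hasSum_integral_of_dominated_convergence (μ := volume.restrict (Ioi (0 : ℝ)))
      (F := fun (j : ℕ) (t : ℝ) => exp (-(t * c) / y) * ((polylogGen ω (t * c / (j + 1)) +
        polylogGen ω (-(t * c / (j + 1)))) / ((j : ℂ) + 1) ^ 2) * c)
      (f := fun t : ℝ => exp (-(t * c) / y) * (∑' j : ℕ, (polylogGen ω (t * c / (j + 1)) +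
        polylogGen ω (-(t * c / (j + 1)))) / ((j : ℂ) + 1) ^ 2) * c)
      (fun j t => 2 * (η⁻¹ + 1) * (1 / ((j : ℝ) + 1) ^ 2) * (‖c‖ * Real.exp (-(t * (c / y).re))))
      (fun j => ?_) (fun j => ?_) ?_ ?_ ?_
    · simp only [integral_borelSum_term hN hωN hω hω1 hc hy] at hs
      have := hs.mul_left (I / (2 * Real.pi))
      rw [← integral_const_mul] at this
      have hB : ∀ t : ℝ, exp (-(t * c) / y) * borelSum ω (t * c) * c = I / (2 * Real.pi) *
          (exp (-(t * c) / y) * (∑' j : ℕ, (polylogGen ω (t * c / (j + 1)) +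
            polylogGen ω (-(t * c / (j + 1)))) / ((j : ℂ) + 1) ^ 2) * c) := fun t => by
        rw [borelSum]; ring
      simp only [hB]
      exact this
    · have := measurable_polylogGen ω
      exact Measurable.aestronglyMeasurable (by fun_prop)
    · refine (ae_restrict_iff' measurableSet_Ioi).mpr (.of_forall fun t ht => ?_)
      rw [norm_mul, norm_mul, hexp]
      have := norm_borelSum_term_le hC hdiv hneg j (hray t ht)
      calc _ ≤ Real.exp (-(t * (c / y).re)) * (2 * (η⁻¹ + 1) * (1 / ((j : ℝ) + 1) ^ 2)) * ‖c‖ := by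
            gcongr
        _ = _ := by ring
    · exact .of_forall fun t => (summable_one_div_succ_sq.mul_left _).mul_right _
    · simp only [tsum_mul_right]
      exact (integrableOn_real_exp_neg hy ‖c‖).const_mul _
    · refine (ae_restrict_iff' measurableSet_Ioi).mpr (.of_forall fun t ht => ?_)
      exact ((summable_borelSum hC hdiv hneg (hray t ht)).hasSum.mul_left _).mul_right _

/-! ### Twisted bilateral sums through the cotangent. -/

theorem isPrimitiveRoot_zetaN {N : ℕ} (hN : N ≠ 0) : IsPrimitiveRoot (zetaN N) N :=
  Complex.isPrimitiveRoot_exp N hN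

theorem sum_range_mul_block (f : ℕ → ℂ) (n N : ℕ) :
    ∑ m ∈ Finset.range (n * N), f m =
      ∑ l ∈ Finset.range n, ∑ r ∈ Finset.range N, f (l * N + r) := by
  induction n with
  | zero => simp
  | succ n ih => rw [Nat.succ_mul, Finset.sum_range_add, ih, Finset.sum_range_succ]

theorem sum_pow_succ_eq_zero {η : ℂ} {N : ℕ} (h : η ^ N = 1) (h1 : η ≠ 1) :
    ∑ r ∈ Finset.range N, η ^ (r + 1) = 0 := by
  simp only [pow_succ, ← Finset.sum_mul, geom_sum_eq h1, h, sub_self, zero_div, zero_mul]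

theorem one_div_sub_one_eq_sum {Y : ℂ} {N : ℕ} (hY : Y ^ N ≠ 1) :
    1 / (Y - 1) = (∑ l ∈ Finset.range N, Y ^ l) / (Y ^ N - 1) := by
  have h1 : Y ≠ 1 := by rintro rfl; exact hY (one_pow N)
  rw [geom_sum_eq h1]
  field_simp [sub_ne_zero.mpr h1, sub_ne_zero.mpr hY]

/-- Expand 1 / (Y - 1) = (1 + Y + ⋯ + Y^{N-1}) / (Y^N - 1). Orthogonality of the characters of ℤ/N
then selects the power l = k. -/
theorem sum_rootsOfUnity_div {N k : ℕ} (hkN : k < N) {ζ X : ℂ} (hζ : IsPrimitiveRoot ζ N)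
    (hX : X ^ N ≠ 1) :
    ∑ r ∈ Finset.range N, (ζ ^ k) ^ (r + 1) * (1 / (X * (ζ⁻¹) ^ (r + 1) - 1)) =
      N * X ^ k / (X ^ N - 1) := by
  have hζ0 : ζ ≠ 0 := hζ.ne_zero (by omega)
  have hYN : ∀ r : ℕ, (X * (ζ⁻¹) ^ (r + 1)) ^ N = X ^ N := fun r => by
    rw [mul_pow, ← pow_mul, mul_comm (r + 1), pow_mul, hζ.inv.pow_eq_one, one_pow, mul_one]
  have hinner : ∀ l ∈ Finset.range N, ∑ r ∈ Finset.range N, (ζ ^ k * (ζ⁻¹) ^ l) ^ (r + 1) =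
      if l = k then (N : ℂ) else 0 := by
    intro l hl
    split_ifs with h
    · subst h
      simp [hζ0]
    · refine sum_pow_succ_eq_zero ?_ ?_
      · rw [mul_pow, ← pow_mul, ← pow_mul, mul_comm k, mul_comm l, pow_mul, pow_mul, inv_pow,
          hζ.pow_eq_one]
        simp
      · intro h'
        rw [inv_pow, mul_inv_eq_one₀ (pow_ne_zero _ hζ0)] at h'
        exact h (hζ.pow_inj (Finset.mem_range.mp hl) hkN h'.symm)
  calc ∑ r ∈ Finset.range N, (ζ ^ k) ^ (r + 1) * (1 / (X * (ζ⁻¹) ^ (r + 1) - 1))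
      = ∑ r ∈ Finset.range N, ∑ l ∈ Finset.range N,
          X ^ l / (X ^ N - 1) * (ζ ^ k * (ζ⁻¹) ^ l) ^ (r + 1) := by
        refine Finset.sum_congr rfl fun r _ => ?_
        rw [one_div_sub_one_eq_sum (by rw [hYN]; exact hX), hYN, Finset.sum_div, Finset.mul_sum]
        refine Finset.sum_congr rfl fun l _ => ?_
        rw [mul_pow X, mul_pow (ζ ^ k), ← pow_mul ζ⁻¹, ← pow_mul ζ⁻¹, mul_comm l]
        ring
    _ = ∑ l ∈ Finset.range N, X ^ l / (X ^ N - 1) * (if l = k then (N : ℂ) else 0) := by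
        rw [Finset.sum_comm]
        refine Finset.sum_congr rfl fun l hl => ?_
        rw [← Finset.mul_sum, hinner l hl]
    _ = _ := by
        simp only [mul_ite, mul_zero, Finset.sum_ite_eq', Finset.mem_range, hkN, if_true]
        ring

theorem mem_integerComplement_of_im_ne_zero {x : ℂ} (hx : x.im ≠ 0) : x ∈ integerComplement := by
  rintro ⟨n, rfl⟩
  simp at hx

theorem pi_mul_cot_eq {x : ℂ} (hx : x.im ≠ 0) :
    Real.pi * cot (Real.pi * x) =
      Real.pi * I + 2 * Real.pi * I * (1 / (exp (2 * Real.pi * I * x) - 1)) := by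
  have h : exp (2 * Real.pi * I * x) - 1 ≠ 0 := by
    intro h
    obtain ⟨n, hn⟩ := exp_eq_one_iff.mp (sub_eq_zero.mp h)
    have hp : (2 * Real.pi * I : ℂ) ≠ 0 := two_pi_I_ne_zero
    rw [mul_comm] at hn
    rw [mul_right_cancel₀ hp hn] at hx
    simp at hx
  rw [cot_pi_eq_exp_ratio, ← neg_sub (exp (2 * Real.pi * I * x)) 1]
  generalize exp (2 * Real.pi * I * x) = E at h
  field_simp
  rw [I_sq]
  ring

theorem exists_re_pos_of_im_ne_zero {w : ℂ} (hw : w.im ≠ 0) :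
    ∃ c : ℂ, 0 < c.re ∧ 0 < (c * w).re := by
  -- The slope is chosen so that Re (c w) = Re w - (Re w - 1) = 1.
  refine ⟨1 + ((w.re - 1) / w.im : ℝ) * I, by simp, ?_⟩
  have : ((1 + ((w.re - 1) / w.im : ℝ) * I) * w).re = 1 := by
    rw [add_mul, one_mul, add_re, mul_assoc, re_ofReal_mul]
    simp only [mul_re, I_re, I_im]
    field_simp
    ring
  rw [this]
  exact one_pos

theorem ne_of_im_ne {z : ℂ} (hz : z.im ≠ 0) (m : ℕ) : z - m ≠ 0 ∧ z + m ≠ 0 := by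
  constructor <;> intro h <;> apply hz <;> simpa using congrArg im h

/-- Sorts integers by residue class mod N. The truncated cotangent at (z - (r + 1)) / N has its
poles at z = r + 1 + lN with |l| ≤ n. Over all r these are the integers from 1 - nN to (n + 1)N.
Hence the n + 1 positive blocks, the separate term 1/z, and the correction 1 / (z + nN) for the last
term of the negative blocks. -/
theorem sum_cotTerm_eq {N : ℕ} (hN : 0 < N) {ω : ℂ} (hω0 : ω ≠ 0) (hωN : ω ^ N = 1) {z : ℂ}
    (hz : z.im ≠ 0) (n : ℕ) :
    ∑ r ∈ Finset.range N, ω ^ (r + 1) / N * (1 / ((z - (r + 1)) / N) +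
        ∑ l ∈ Finset.range n, cotTerm ((z - (r + 1)) / N) l) =
      1 / z + blockSum N ω⁻¹ z n - blockSum N ω (-z) (n + 1) - 1 / (z + n * N) := by
  have hN0 : (N : ℂ) ≠ 0 := by exact_mod_cast hN.ne'
  have hpos : -blockSum N ω (-z) (n + 1) = ∑ r ∈ Finset.range N, (ω ^ (r + 1) / (z - (r + 1)) +
      ∑ l ∈ Finset.range n, ω ^ (r + 1) / (z - ((l + 1) * N + r + 1))) := by
    rw [blockSum, sum_range_mul_block, Finset.sum_comm, ← Finset.sum_neg_distrib]
    refine Finset.sum_congr rfl fun r _ => ?_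
    rw [Finset.sum_range_succ', neg_add_rev, ← Finset.sum_neg_distrib]
    congr 1
    · have h2 := (ne_of_im_ne hz (r + 1)).1
      push_cast at h2
      rw [neg_eq_iff_eq_neg, ← div_neg]
      push_cast
      congr 1
      · simp
      · ring
    · refine Finset.sum_congr rfl fun l _ => ?_
      rw [neg_eq_iff_eq_neg, ← div_neg]
      congr 1
      · rw [show (l + 1) * N + r + 1 = N * (l + 1) + (r + 1) by ring, pow_add, pow_mul, hωN]
        simp
      · push_cast; ring
  have hneg : 1 / z + blockSum N ω⁻¹ z n - 1 / (z + n * N) =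
      ∑ r ∈ Finset.range N, ∑ l ∈ Finset.range n, ω ^ (r + 1) / (z - (r + 1) + (l + 1) * N) := by
    have h1 : 1 / z + blockSum N ω⁻¹ z n = ∑ m ∈ Finset.range (n * N + 1), (ω⁻¹) ^ m / (z + m) := by
      rw [Finset.sum_range_succ', add_comm, blockSum]
      congr 1
      · refine Finset.sum_congr rfl fun m _ => ?_
        push_cast
        rw [add_comm z]
      · simp
    have h2 : (ω⁻¹) ^ (n * N) = 1 := by rw [mul_comm, pow_mul, inv_pow, hωN]; simp
    rw [h1, Finset.sum_range_succ, h2]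
    push_cast
    rw [add_sub_cancel_right, sum_range_mul_block, Finset.sum_comm, ← Finset.sum_range_reflect]
    refine Finset.sum_congr rfl fun r hr => Finset.sum_congr rfl fun l _ => ?_
    have hr' := Finset.mem_range.mp hr
    have e : ((N - 1 - r : ℕ) : ℂ) = N - (r + 1) := by
      rw [Nat.sub_sub, Nat.cast_sub (by omega)]; push_cast; ring
    congr 1
    · rw [inv_pow]
      refine inv_eq_of_mul_eq_one_right ?_
      rw [← pow_add, show l * N + (N - 1 - r) + (r + 1) = N * (l + 1) by
          have : N - 1 - r + (r + 1) = N := by omega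
          rw [add_assoc, this]; ring, pow_mul, hωN, one_pow]
    · push_cast [e]; ring
  rw [sub_right_comm, sub_eq_add_neg, hneg, hpos, ← Finset.sum_add_distrib]
  refine Finset.sum_congr rfl fun r _ => ?_
  rw [mul_add, Finset.mul_sum, add_comm (∑ l ∈ _, _), add_assoc, ← Finset.sum_add_distrib]
  congr 1
  · field_simp
  · refine Finset.sum_congr rfl fun l _ => ?_
    have e1 := (ne_of_im_ne hz ((l + 1) * N + r + 1)).1
    have e2 : z - (r + 1) + (l + 1) * N ≠ 0 := by
      intro h; apply hz; simpa using congrArg im h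
    push_cast at e1
    have e3 : (z - (r + 1)) / N - (l + 1) = (z - ((l + 1) * N + r + 1)) / N := by
      field_simp; ring
    have e4 : (z - (r + 1)) / N + (l + 1) = (z - (r + 1) + (l + 1) * N) / N := by
      field_simp
    rw [cotTerm, e3, e4]
    field_simp

theorem tendsto_one_div_add_mul_nat {N : ℕ} (hN : 0 < N) (z : ℂ) :
    Tendsto (fun n : ℕ => 1 / (z + n * N)) atTop (𝓝 0) := by
  simp only [one_div]
  refine tendsto_inv₀_cobounded.comp ?_
  refine tendsto_norm_atTop_iff_cobounded.mp ?_
  have h : Tendsto (fun n : ℕ => (n : ℝ) * N - ‖z‖) atTop atTop :=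
    tendsto_atTop_add_const_right _ _
      (tendsto_natCast_atTop_atTop.atTop_mul_const (by exact_mod_cast hN))
  refine tendsto_atTop_mono (fun n => ?_) h
  have := norm_sub_le (z + n * N) z
  rw [add_sub_cancel_left, norm_mul, norm_natCast, norm_natCast] at this
  linarith

theorem one_div_add_blockLim_sub_blockLim {N k : ℕ} (hk : 1 ≤ k) (hkN : k < N) {z : ℂ}
    (hz : z.im < 0) :
    1 / z + blockLim N (zetaN N ^ k)⁻¹ z - blockLim N (zetaN N ^ k) (-z) =
      2 * Real.pi * I * (exp (2 * Real.pi * I * (z / N)) ^ k /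
        (exp (2 * Real.pi * I * (z / N)) ^ N - 1)) := by
  have hN : 0 < N := by omega
  have hN0 : (N : ℂ) ≠ 0 := by exact_mod_cast hN.ne'
  have hζ := isPrimitiveRoot_zetaN hN.ne'
  set ω := zetaN N ^ k with hωdef
  have hωN : ω ^ N = 1 := by rw [hωdef, ← pow_mul, mul_comm, pow_mul, hζ.pow_eq_one, one_pow]
  have hω : ω ≠ 1 := hζ.pow_ne_one_of_pos_of_lt (by omega) hkN
  have hω1 : ‖ω‖ = 1 := Complex.norm_eq_one_of_pow_eq_one hωN hN.ne'
  have hω0 : ω ≠ 0 := norm_ne_zero_iff.mp (by rw [hω1]; exact one_ne_zero)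
  -- The points z and -z need different rays, since Re (c z) must be nonnegative in each case.
  obtain ⟨c, hc, hcz⟩ := exists_re_pos_of_im_ne_zero hz.ne
  obtain ⟨d, hd, hdz⟩ := exists_re_pos_of_im_ne_zero (w := -z) (by simpa using hz.ne)
  have t1 := tendsto_blockSum hN (ω := ω⁻¹) (by rw [inv_pow, hωN, inv_one]) (inv_ne_one.mpr hω)
    (by rw [norm_inv, hω1, inv_one]) hc hcz.le
  have t2 := (tendsto_blockSum hN hωN hω hω1 hd hdz.le).comp (tendsto_add_atTop_nat 1)
  have t3 := ((t1.const_add (1 / z)).sub t2).sub (tendsto_one_div_add_mul_nat hN z)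
  rw [sub_zero] at t3
  have him : ∀ r : ℕ, ((z - (r + 1)) / N).im ≠ 0 := fun r => by
    rw [← ofReal_natCast N, div_ofReal_im]
    simpa [hN.ne'] using hz.ne
  have t4 : Tendsto (fun n : ℕ => ∑ r ∈ Finset.range N, ω ^ (r + 1) / N *
      (1 / ((z - (r + 1)) / N) + ∑ l ∈ Finset.range n, cotTerm ((z - (r + 1)) / N) l)) atTop
      (𝓝 (∑ r ∈ Finset.range N, ω ^ (r + 1) / N *
        (Real.pi * cot (Real.pi * ((z - (r + 1)) / N))))) := by
    refine tendsto_finsetSum _ fun r _ => Tendsto.const_mul _ ?_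
    have := (tendsto_logDeriv_euler_cot_sub
      (mem_integerComplement_of_im_ne_zero (him r))).const_add (1 / ((z - (r + 1)) / N))
    rwa [add_sub_cancel] at this
  have heq := tendsto_nhds_unique t3 (t4.congr fun n => sum_cotTerm_eq hN hω0 hωN hz.ne n)
  rw [heq]
  set X := exp (2 * Real.pi * I * (z / N)) with hX
  have hXN : X ^ N ≠ 1 := by
    intro h
    have h1 := congrArg norm h
    have h2 : (N : ℂ) * (2 * Real.pi * I * (z / N)) = ((2 * Real.pi : ℝ) : ℂ) * (I * z) := by
      push_cast; field_simp
    rw [hX, ← exp_nat_mul, norm_exp, norm_one, h2, re_ofReal_mul, Real.exp_eq_one_iff] at h1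
    have : (I * z).re = -z.im := by simp
    rw [this] at h1
    have := Real.pi_pos
    nlinarith
  have hE : ∀ r : ℕ, exp (2 * Real.pi * I * ((z - (r + 1)) / N)) =
      X * ((zetaN N)⁻¹) ^ (r + 1) := fun r => by
    rw [hX, zetaN, ← exp_neg, ← exp_nat_mul, ← exp_add]
    congr 1
    push_cast
    ring
  have hs := sum_rootsOfUnity_div hkN hζ hXN
  have h0 := sum_pow_succ_eq_zero hωN hω
  calc ∑ r ∈ Finset.range N, ω ^ (r + 1) / N * (Real.pi * cot (Real.pi * ((z - (r + 1)) / N)))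
      = ∑ r ∈ Finset.range N, (Real.pi * I / N * ω ^ (r + 1) + 2 * Real.pi * I / N *
          (ω ^ (r + 1) * (1 / (X * ((zetaN N)⁻¹) ^ (r + 1) - 1)))) := by
        refine Finset.sum_congr rfl fun r _ => ?_
        rw [pi_mul_cot_eq (him r), hE]
        ring
    _ = _ := by
        -- The constant πi of π cot drops out because the powers of ω over a full period sum to 0.
        rw [Finset.sum_add_distrib, ← Finset.mul_sum, ← Finset.mul_sum, h0, hs]
        field_simp
        ring

/-! ### Lambert series and partial fractions for log (ω; q)_∞. -/

theorem summable_qPochhammer_double {x q : ℂ} (hx : ‖x‖ < 1) (hq : ‖q‖ < 1) :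
    Summable fun p : ℕ × ℕ => (x * q ^ p.1) ^ (p.2 + 1) / ((p.2 : ℂ) + 1) := by
  have h1 : Summable fun n : ℕ => ‖q‖ ^ n := summable_geometric_of_lt_one (norm_nonneg _) hq
  have h2 : Summable fun j : ℕ => ‖x‖ ^ (j + 1) :=
    (summable_nat_add_iff 1).mpr (summable_geometric_of_lt_one (norm_nonneg _) hx)
  refine .of_norm_bounded (h1.mul_of_nonneg h2 (fun _ => by positivity) fun _ => by positivity)
    fun p => ?_
  rw [norm_div, norm_natCast_add_one, norm_pow, norm_mul, norm_pow, mul_pow, mul_comm]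
  refine (div_le_self (by positivity) (by simp)).trans ?_
  gcongr
  exact pow_le_of_le_one (by positivity) (pow_le_one₀ (norm_nonneg _) hq.le) (by omega)

theorem hasSum_pow_div_neg_log {x : ℂ} (hx : ‖x‖ < 1) :
    HasSum (fun j : ℕ => x ^ (j + 1) / ((j : ℂ) + 1)) (-log (1 - x)) := by
  have := (hasSum_nat_add_iff' 1).mpr (hasSum_taylorSeries_neg_log hx)
  simpa using this

theorem hasSum_neg_logQPochhammerInf {x q : ℂ} (hx : ‖x‖ < 1) (hq : ‖q‖ < 1) :
    HasSum (fun j : ℕ => x ^ (j + 1) / (((j : ℂ) + 1) * (1 - q ^ (j + 1))))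
      (-logQPochhammerInf x q) := by
  have hrow : ∀ n : ℕ, HasSum (fun j : ℕ => (x * q ^ n) ^ (j + 1) / ((j : ℂ) + 1))
      (-log (1 - x * q ^ n)) := fun n => hasSum_pow_div_neg_log (by
    rw [norm_mul, norm_pow]
    exact (mul_le_of_le_one_right (norm_nonneg _) (pow_le_one₀ (norm_nonneg _) hq.le)).trans_lt hx)
  have hcol : ∀ j : ℕ, HasSum (fun n : ℕ => (x * q ^ n) ^ (j + 1) / ((j : ℂ) + 1))
      (x ^ (j + 1) / (((j : ℂ) + 1) * (1 - q ^ (j + 1)))) := fun j => by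
    have hqj : ‖q ^ (j + 1)‖ < 1 := by
      rw [norm_pow]; exact pow_lt_one₀ (norm_nonneg _) hq (by omega)
    have := (hasSum_geometric_of_norm_lt_one hqj).mul_left (x ^ (j + 1) / ((j : ℂ) + 1))
    rw [← div_eq_mul_inv, div_div] at this
    refine this.congr_fun fun n => ?_
    rw [mul_pow, ← pow_mul, ← pow_mul, mul_comm n]
    ring
  have := hasSum_col_of_row (summable_qPochhammer_double hx hq) hrow hcol
  rwa [tsum_neg] at this

theorem norm_exp_two_pi_I_mul_lt_one {y : ℂ} (hy : 0 < y.im) :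
    ‖exp (2 * Real.pi * I * y)‖ < 1 := by
  have h2 : 2 * Real.pi * I * y = ((2 * Real.pi : ℝ) : ℂ) * (I * y) := by push_cast; ring
  rw [norm_exp, h2, re_ofReal_mul, Real.exp_lt_one_iff]
  have : (I * y).re = -y.im := by simp
  rw [this]
  have := Real.pi_pos
  nlinarith

theorem hasSum_log_sub_fkN {N k : ℕ} (hω1 : ‖zetaN N ^ k‖ = 1) {y : ℂ} (hy : 0 < y.im) :
    HasSum (fun m : ℕ => (zetaN N ^ k) ^ (m + 1) / ((m : ℂ) + 1) *
        (exp (2 * Real.pi * I * y) ^ (m + 1) / (1 - exp (2 * Real.pi * I * y) ^ (m + 1))))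
      (log (1 - zetaN N ^ k) - fkN k N y) := by
  set ω := zetaN N ^ k with hω
  set q := exp (2 * Real.pi * I * y) with hqdef
  have hq : ‖q‖ < 1 := norm_exp_two_pi_I_mul_lt_one hy
  have hx : ‖ω * q‖ < 1 := by rwa [norm_mul, hω1, one_mul]
  -- The factor n = 0 has |ω| = 1, outside the open disc where the Lambert expansion is available,
  -- so it is split off.
  have h1 : fkN k N y = log (1 - ω) + logQPochhammerInf (ω * q) q := by
    rw [fkN, logQPochhammerInf, (logQPochhammerInf_spec ω q hq).1.tsum_eq_zero_add, pow_zero,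
      mul_one, logQPochhammerInf]
    simp only [pow_succ', mul_assoc]
  rw [h1, sub_add_cancel_left]
  refine (hasSum_neg_logQPochhammerInf hx hq).congr_fun fun m => ?_
  rw [mul_pow, div_mul_div_comm]

theorem pow_div_one_sub_eq_cot {y : ℂ} (hy : 0 < y.im) (m : ℕ) :
    exp (2 * Real.pi * I * y) ^ (m + 1) / (1 - exp (2 * Real.pi * I * y) ^ (m + 1)) =
      -1 / 2 + I / (2 * Real.pi) * (1 / ((m + 1) * y) + ∑' j : ℕ, cotTerm ((m + 1) * y) j) := by
  have him : (((m : ℂ) + 1) * y).im ≠ 0 := by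
    have : ((m : ℂ) + 1) * y = (((m : ℝ) + 1 : ℝ) : ℂ) * y := by push_cast; rfl
    rw [this, im_ofReal_mul]
    positivity
  have h := cot_series_rep' (mem_integerComplement_of_im_ne_zero him)
  have h2 : ∑' j : ℕ, cotTerm ((m + 1) * y) j =
      Real.pi * cot (Real.pi * ((m + 1) * y)) - 1 / ((m + 1) * y) := by
    exact h.symm
  have hE : exp (2 * Real.pi * I * ((m + 1) * y)) = exp (2 * Real.pi * I * y) ^ (m + 1) := by
    rw [← exp_nat_mul]; congr 1; push_cast; ring
  have hlt : ‖exp (2 * Real.pi * I * y) ^ (m + 1)‖ < 1 := by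
    rw [norm_pow]
    exact pow_lt_one₀ (norm_nonneg _) (norm_exp_two_pi_I_mul_lt_one hy) (by omega)
  rw [h2, add_sub_cancel, pi_mul_cot_eq him, hE]
  generalize exp (2 * Real.pi * I * y) ^ (m + 1) = E at hlt
  have h3 : 1 - E ≠ 0 := sub_ne_zero.mpr (by rintro rfl; simp at hlt)
  have hpi : (Real.pi : ℂ) ≠ 0 := by exact_mod_cast Real.pi_ne_zero
  rw [← neg_sub 1 E]
  field_simp
  ring_nf
  rw [I_sq]
  ring

/-- A partial fraction in m that moves the factor 1/m to 1/j, so that for fixed j the sum over m is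
of the type L(ω, ±j/y). -/
theorem cotTerm_div_eq {y : ℂ} (hy : y.im ≠ 0) (m j : ℕ) :
    cotTerm ((m + 1) * y) j / ((m : ℂ) + 1) = 1 / ((j : ℂ) + 1) *
      (1 / ((m : ℂ) + 1 + -((j + 1) / y)) - 1 / ((m : ℂ) + 1 + (j + 1) / y)) := by
  have hy0 : y ≠ 0 := by rintro rfl; simp at hy
  have hm := natCast_add_one_ne_zero' m
  have hj := natCast_add_one_ne_zero' j
  have him : (((m : ℂ) + 1) * y).im ≠ 0 := by
    have : ((m : ℂ) + 1) * y = (((m : ℝ) + 1 : ℝ) : ℂ) * y := by push_cast; rfl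
    rw [this, im_ofReal_mul]
    exact mul_ne_zero (by positivity) hy
  have h := ne_of_im_ne him (j + 1)
  push_cast at h
  obtain ⟨h1, h2⟩ := h
  have e1 : (m : ℂ) + 1 + -((j + 1) / y) = ((m + 1) * y - (j + 1)) / y := by field_simp; ring
  have e2 : (m : ℂ) + 1 + (j + 1) / y = ((m + 1) * y + (j + 1)) / y := by field_simp
  rw [e1, e2, cotTerm]
  field_simp
  ring

/-- With c = 1 and z = 0 the integrand has the antiderivative log (1 - ω e^{-t}). The argument has
positive real part for t ≥ 0, so the principal branch is never left. It tends to 1 at infinity. -/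
theorem blockLim_zero {N : ℕ} (hN : 0 < N) {ω : ℂ} (hωN : ω ^ N = 1) (hω : ω ≠ 1)
    (hω1 : ‖ω‖ = 1) : blockLim N ω 0 = -log (1 - ω) := by
  rw [blockLim_eq_integral hN hωN hω hω1 (c := 1) (by simp) (by simp)]
  simp only [mul_zero, neg_zero, exp_zero, one_mul, mul_one]
  obtain ⟨η, hη, h⟩ := exists_ray_le_norm_one_sub_mul_exp hω hω1 (c := 1) (by simp)
  have hslit : ∀ t : ℝ, 0 ≤ t → 1 - ω * exp (-(t : ℂ)) ∈ slitPlane := by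
    intro t ht
    have hn : ‖ω * exp (-(t : ℂ))‖ = Real.exp (-t) := by
      rw [norm_mul, hω1, one_mul, norm_exp]; simp
    refine Or.inl ?_
    rw [sub_re, one_re, sub_pos]
    rcases ht.eq_or_lt with rfl | ht
    · simp only [ofReal_zero, neg_zero, exp_zero, mul_one]
      refine lt_of_le_of_ne ((re_le_norm ω).trans hω1.le) fun hre => hω ?_
      have := Complex.re_eq_norm.mp (hre.trans hω1.symm)
      apply Complex.ext
      · simpa using hre
      · simpa using (Complex.nonneg_iff.mp this).2.symm
    · refine (re_le_norm _).trans_lt ?_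
      rw [hn]
      exact Real.exp_lt_one_iff.mpr (by linarith)
  have hd : ∀ t ∈ Ici (0 : ℝ), HasDerivAt (fun t : ℝ => log (1 - ω * exp (-(t : ℂ))))
      (polylogGen ω (-(t : ℂ))) t := by
    intro t ht
    have h1 : HasDerivAt (fun t : ℝ => -(t : ℂ)) (-1) t := (hasDerivAt_id t).ofReal_comp.neg
    have h2 := ((h1.cexp.const_mul ω).const_sub 1).clog_real (hslit t ht)
    convert h2 using 1
    rw [polylogGen]
    ring
  have hlim : Tendsto (fun t : ℝ => log (1 - ω * exp (-(t : ℂ)))) atTop (𝓝 0) := by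
    have h1 : Tendsto (fun t : ℝ => exp (-(t : ℂ))) atTop (𝓝 0) := by
      rw [tendsto_zero_iff_norm_tendsto_zero]
      simp only [norm_exp, neg_re, ofReal_re]
      exact Real.tendsto_exp_neg_atTop_nhds_zero
    have h2 : Tendsto (fun t : ℝ => 1 - ω * exp (-(t : ℂ))) atTop (𝓝 1) := by
      simpa using (h1.const_mul ω).const_sub 1
    simpa using h2.clog (by simp)
  have hint : IntegrableOn (fun t : ℝ => polylogGen ω (-(t : ℂ))) (Ioi 0) := by
    refine (integrableOn_real_exp_neg one_pos η⁻¹).mono' ?_ ?_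
    · have := measurable_polylogGen ω
      exact Measurable.aestronglyMeasurable (by fun_prop)
    · refine (ae_restrict_iff' measurableSet_Ioi).mpr (.of_forall fun t ht => ?_)
      have h1 := h t ht
      rw [mul_one] at h1
      have h2 := norm_polylogGen_le_exp hω1 hη h1
      rw [neg_re, ofReal_re] at h2
      rw [mul_one]
      exact h2.trans_eq (div_eq_inv_mul _ _)
  rw [integral_Ioi_of_hasDerivAt_of_tendsto' hd hint hlim]
  simp

theorem hasSum_dilog {ω : ℂ} (hω1 : ‖ω‖ = 1) :
    HasSum (fun m : ℕ => ω ^ (m + 1) / ((m : ℂ) + 1) ^ 2) (dilog ω) := by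
  refine (Summable.of_norm_bounded summable_one_div_succ_sq fun m => ?_).hasSum
  rw [norm_div, norm_pow, norm_pow, hω1, one_pow, norm_natCast_add_one]

section
variable {N : ℕ} {ω : ℂ}

theorem exists_norm_blockSum_dilate_le (hωN : ω ^ N = 1) (hω : ω ≠ 1)
    (hω1 : ‖ω‖ = 1) {w : ℂ} (hw : w.im ≠ 0) :
    ∃ K, ∀ j n : ℕ, ‖1 / ((j : ℂ) + 1) * blockSum N ω ((j + 1) * w) n‖ ≤
      K * (1 / ((j : ℝ) + 1) ^ 2) := by
  obtain ⟨c, hc, hcw⟩ := exists_re_pos_of_im_ne_zero hw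
  obtain ⟨K, hK⟩ := exists_norm_blockSum_le hωN hω hω1 hc
  refine ⟨K / (c * w).re, fun j n => ?_⟩
  have e : (c * ((j + 1) * w)).re = (j + 1) * (c * w).re := by
    have : c * ((j + 1) * w) = (((j : ℝ) + 1 : ℝ) : ℂ) * (c * w) := by push_cast; ring
    rw [this, re_ofReal_mul]
  have h := hK ((j + 1) * w) (by rw [e]; positivity) n
  rw [e] at h
  rw [norm_mul, norm_div, norm_one, norm_natCast_add_one]
  calc _ ≤ 1 / ((j : ℝ) + 1) * (K / ((j + 1) * (c * w).re)) := by gcongr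
    _ = _ := by field_simp

theorem tendsto_blockSum_of_im_ne_zero (hN : 0 < N) (hωN : ω ^ N = 1) (hω : ω ≠ 1)
    (hω1 : ‖ω‖ = 1) {w : ℂ} (hw : w.im ≠ 0) :
    Tendsto (blockSum N ω w) atTop (𝓝 (blockLim N ω w)) := by
  obtain ⟨c, hc, hcw⟩ := exists_re_pos_of_im_ne_zero hw
  exact tendsto_blockSum hN hωN hω hω1 hc hcw.le

theorem im_natCast_add_one_mul_ne_zero {w : ℂ} (hw : w.im ≠ 0) (j : ℕ) :
    (((j : ℂ) + 1) * w).im ≠ 0 := by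
  have : ((j : ℂ) + 1) * w = (((j : ℝ) + 1 : ℝ) : ℂ) * w := by push_cast; rfl
  rw [this, im_ofReal_mul]
  exact mul_ne_zero (by positivity) hw

theorem tendsto_tsum_blockSum (hN : 0 < N) (hωN : ω ^ N = 1) (hω : ω ≠ 1)
    (hω1 : ‖ω‖ = 1) {w : ℂ} (hw : w.im ≠ 0) :
    (∀ n, Summable fun j : ℕ => 1 / ((j : ℂ) + 1) * blockSum N ω ((j + 1) * w) n) ∧
    (Summable fun j : ℕ => 1 / ((j : ℂ) + 1) * blockLim N ω ((j + 1) * w)) ∧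
    Tendsto (fun n => ∑' j : ℕ, 1 / ((j : ℂ) + 1) * blockSum N ω ((j + 1) * w) n) atTop
      (𝓝 (∑' j : ℕ, 1 / ((j : ℂ) + 1) * blockLim N ω ((j + 1) * w))) := by
  obtain ⟨K, hK⟩ := exists_norm_blockSum_dilate_le hωN hω hω1 hw
  have hlim := fun j : ℕ => (tendsto_blockSum_of_im_ne_zero hN hωN hω hω1
    (im_natCast_add_one_mul_ne_zero hw j)).const_mul (1 / ((j : ℂ) + 1))
  have hs := summable_one_div_succ_sq.mul_left K
  refine ⟨fun n => .of_norm_bounded hs fun j => hK j n, .of_norm_bounded hs fun j => ?_, ?_⟩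
  · exact le_of_tendsto (hlim j).norm (.of_forall fun n => hK j n)
  · exact tendsto_tsum_of_dominated_convergence hs hlim (.of_forall fun n j => hK j n)

end

/-- The sum over m converges only conditionally, so it is truncated to n blocks. The finite sum over
m commutes with the sum over j. The bound K / (j + 1)², uniform in n, then lets n → ∞ inside the sum
over j. -/
theorem hasSum_fkN_sub {N k : ℕ} (hk : 1 ≤ k) (hkN : k < N) {y : ℂ} (hy : 0 < y.im) :
    HasSum (fun j : ℕ => I / (2 * Real.pi) * (1 / ((j : ℂ) + 1) *
        (blockLim N (zetaN N ^ k) ((j + 1) / y) - blockLim N (zetaN N ^ k) (-((j + 1) / y)))))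
      (fkN k N y - (1 / 2 * log (1 - zetaN N ^ k) +
        dilog (zetaN N ^ k) / (2 * Real.pi * I) * y⁻¹)) := by
  have hN : 0 < N := by omega
  have hζ := isPrimitiveRoot_zetaN hN.ne'
  set ω := zetaN N ^ k with hωdef
  have hωN : ω ^ N = 1 := by rw [hωdef, ← pow_mul, mul_comm, pow_mul, hζ.pow_eq_one, one_pow]
  have hω : ω ≠ 1 := hζ.pow_ne_one_of_pos_of_lt (by omega) hkN
  have hω1 : ‖ω‖ = 1 := Complex.norm_eq_one_of_pow_eq_one hωN hN.ne'
  have hy0 : y ≠ 0 := by rintro rfl; simp at hy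
  have hw : (y⁻¹).im ≠ 0 := by
    rw [inv_im]
    exact div_ne_zero (neg_ne_zero.mpr hy.ne') (normSq_pos.mpr hy0).ne'
  obtain ⟨s1, s2, s3⟩ := tendsto_tsum_blockSum hN hωN hω hω1 hw
  obtain ⟨r1, r2, r3⟩ := tendsto_tsum_blockSum hN hωN hω hω1 (w := -y⁻¹) (by simpa using hw)
  have ediv : ∀ j : ℕ, ((j : ℂ) + 1) * y⁻¹ = (j + 1) / y := fun j => (div_eq_mul_inv _ _).symm
  have eneg : ∀ j : ℕ, ((j : ℂ) + 1) * -y⁻¹ = -((j + 1) / y) := fun j => by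
    rw [mul_neg, ediv]
  simp only [ediv] at s1 s2 s3
  simp only [eneg] at r1 r2 r3
  set A := ∑' j : ℕ, 1 / ((j : ℂ) + 1) * blockLim N ω ((j + 1) / y) with hA
  set B := ∑' j : ℕ, 1 / ((j : ℂ) + 1) * blockLim N ω (-((j + 1) / y)) with hB
  have hAB := (s2.hasSum.sub r2.hasSum).mul_left (I / (2 * Real.pi))
  have hmul : Tendsto (fun n : ℕ => n * N) atTop atTop := tendsto_id.atTop_mul_const' hN
  have t1 := (hasSum_log_sub_fkN hω1 hy).tendsto_sum_nat.comp hmul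
  have t0 := (tendsto_blockSum hN hωN hω hω1 (c := 1) (z := 0) (by simp) (by simp)).const_mul
    (-1 / 2 : ℂ)
  rw [blockLim_zero hN hωN hω hω1] at t0
  have t2 := ((hasSum_dilog hω1).tendsto_sum_nat.comp hmul).const_mul (I / (2 * Real.pi) * y⁻¹)
  have t3 := (r3.sub s3).const_mul (I / (2 * Real.pi))
  -- The three parts of q^m / (1 - q^m) are the constant -1/2, the pole 1/(my) and the remaining
  -- cotangent terms. They produce the logarithm, the dilogarithm and the double sum.
  have hterm : ∀ m : ℕ, ω ^ (m + 1) / ((m : ℂ) + 1) *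
      (exp (2 * Real.pi * I * y) ^ (m + 1) / (1 - exp (2 * Real.pi * I * y) ^ (m + 1))) =
      -1 / 2 * (ω ^ (m + 1) / ((m : ℂ) + 1 + 0)) +
      I / (2 * Real.pi) * y⁻¹ * (ω ^ (m + 1) / ((m : ℂ) + 1) ^ 2) +
      I / (2 * Real.pi) * ∑' j : ℕ, (1 / ((j : ℂ) + 1) *
        (ω ^ (m + 1) / ((m : ℂ) + 1 + -((j + 1) / y))) -
        1 / ((j : ℂ) + 1) * (ω ^ (m + 1) / ((m : ℂ) + 1 + (j + 1) / y))) := by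
    intro m
    have hm := natCast_add_one_ne_zero' m
    have : ∀ j : ℕ, 1 / ((j : ℂ) + 1) * (ω ^ (m + 1) / ((m : ℂ) + 1 + -((j + 1) / y))) -
        1 / ((j : ℂ) + 1) * (ω ^ (m + 1) / ((m : ℂ) + 1 + (j + 1) / y)) =
        ω ^ (m + 1) / ((m : ℂ) + 1) * cotTerm ((m + 1) * y) j := fun j => by
      linear_combination -(ω ^ (m + 1)) * cotTerm_div_eq hy.ne' m j
    rw [tsum_congr this, tsum_mul_left, pow_div_one_sub_eq_cot hy]
    field_simp
    ring
  have hcot : ∀ m : ℕ, Summable fun j : ℕ => 1 / ((j : ℂ) + 1) *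
        (ω ^ (m + 1) / ((m : ℂ) + 1 + -((j + 1) / y))) -
        1 / ((j : ℂ) + 1) * (ω ^ (m + 1) / ((m : ℂ) + 1 + (j + 1) / y)) := by
    intro m
    have h1 : (((m : ℂ) + 1) * y).im ≠ 0 := im_natCast_add_one_mul_ne_zero hy.ne' m
    refine ((summable_cotTerm (mem_integerComplement_of_im_ne_zero h1)).mul_left
      (ω ^ (m + 1) / ((m : ℂ) + 1))).congr fun j => ?_
    linear_combination (ω ^ (m + 1)) * cotTerm_div_eq hy.ne' m j
  have hsum : ∀ n : ℕ, ∑ m ∈ Finset.range (n * N), ω ^ (m + 1) / ((m : ℂ) + 1) *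
      (exp (2 * Real.pi * I * y) ^ (m + 1) / (1 - exp (2 * Real.pi * I * y) ^ (m + 1))) =
      -1 / 2 * blockSum N ω 0 n +
      I / (2 * Real.pi) * y⁻¹ * ∑ m ∈ Finset.range (n * N), ω ^ (m + 1) / ((m : ℂ) + 1) ^ 2 +
      I / (2 * Real.pi) * ((∑' j : ℕ, 1 / ((j : ℂ) + 1) * blockSum N ω (-((j + 1) / y)) n) -
        ∑' j : ℕ, 1 / ((j : ℂ) + 1) * blockSum N ω ((j + 1) / y) n) := by
    intro n
    rw [← (r1 n).tsum_sub (s1 n)]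
    simp only [blockSum, Finset.mul_sum, ← Finset.sum_sub_distrib]
    rw [Summable.tsum_finsetSum fun m _ => hcot m, Finset.mul_sum, ← Finset.sum_add_distrib,
      ← Finset.sum_add_distrib]
    exact Finset.sum_congr rfl fun m _ => hterm m
  have huniq := tendsto_nhds_unique t1
    (((t0.add t2).add t3).congr fun n => (hsum n).symm)
  have hfinal : fkN k N y - (1 / 2 * log (1 - ω) + dilog ω / (2 * Real.pi * I) * y⁻¹) =
      I / (2 * Real.pi) * (A - B) := by
    have e : dilog ω / (2 * Real.pi * I) = -(I / (2 * Real.pi) * dilog ω) := by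
      have hpi : (Real.pi : ℂ) ≠ 0 := by exact_mod_cast Real.pi_ne_zero
      field_simp
      rw [I_sq]
      ring
    rw [e]
    linear_combination -huniq
  rw [hfinal]
  exact hAB.congr_fun fun j => by rw [mul_sub]

/-- With Q = e^{2πi(-1/(Ny))} the exponential equals Q^{-(j+1)}. The quotient is thus the Lambert
summand with numerator Q^{(j+1)(N-b)} = Q^{(j+1)a}. -/
theorem hasSum_neg_gkN {N a b : ℕ} (ha : 1 ≤ a) (hab : a + b = N) {y : ℂ} (hy : 0 < y.im) :
    HasSum (fun j : ℕ => 1 / ((j : ℂ) + 1) *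
        (exp (2 * Real.pi * I * ((j + 1) / y / N)) ^ b /
          (exp (2 * Real.pi * I * ((j + 1) / y / N)) ^ N - 1)))
      (-gkN a N (-1 / (N * y))) := by
  have hN : 0 < N := by omega
  have hy0 : y ≠ 0 := by rintro rfl; simp at hy
  have hτ : 0 < (-1 / (N * y)).im := by
    have : -1 / (N * y) = ((N : ℝ)⁻¹ : ℝ) * -y⁻¹ := by push_cast; field_simp
    rw [this, im_ofReal_mul, neg_im, inv_im, neg_div, neg_neg]
    have := normSq_pos.mpr hy0
    positivity
  have hQ := norm_exp_two_pi_I_mul_lt_one hτ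
  set Q := exp (2 * Real.pi * I * (-1 / (N * y))) with hQdef
  have hpow : ∀ n : ℕ, n ≠ 0 → ‖Q ^ n‖ < 1 := fun n hn => by
    rw [norm_pow]; exact pow_lt_one₀ (norm_nonneg _) hQ hn
  have := hasSum_neg_logQPochhammerInf (hpow a (by omega)) (hpow N (by omega))
  refine this.congr_fun fun j => ?_
  have hX : exp (2 * Real.pi * I * ((j + 1) / y / N)) = (Q ^ (j + 1))⁻¹ := by
    rw [hQdef, ← exp_nat_mul, ← exp_neg]
    congr 1
    push_cast
    field_simp
  have hj := natCast_add_one_ne_zero' j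
  have hP0 : Q ^ (j + 1) ≠ 0 := pow_ne_zero _ (exp_ne_zero _)
  have hP1 : (Q ^ (j + 1)) ^ N ≠ 1 := by
    intro h
    have := hpow ((j + 1) * N) (by positivity)
    rw [pow_mul, h] at this
    simp at this
  rw [hX, ← pow_mul Q a, ← pow_mul Q N, mul_comm a, mul_comm N, pow_mul, pow_mul]
  generalize Q ^ (j + 1) = P at hP0 hP1
  have h1 : 1 - P ^ N ≠ 0 := sub_ne_zero.mpr hP1.symm
  have h2 : (P⁻¹) ^ N - 1 = (1 - P ^ N) / P ^ N := by
    rw [inv_pow]; field_simp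
  rw [h2, inv_pow, ← hab, pow_add]
  rw [← hab, pow_add] at h1
  field_simp

/-! ### Assembling the Borel–Laplace sums and the median. -/

theorem finsum_fTilde (k N : ℕ) (y : ℂ) :
    (∑ᶠ n : {n : ℤ // n ≤ 0}, (fTilde k N).coeff n * y ^ (n : ℤ)) =
      1 / 2 * log (1 - zetaN N ^ k) + dilog (zetaN N ^ k) / (2 * Real.pi * I) * y⁻¹ := by
  have hcoeff : ∀ n : ℤ, n ≤ 0 → (fTilde k N).coeff n =
      (if n = 0 then 1 / 2 * log (1 - zetaN N ^ k) else 0) +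
      (if n = -1 then dilog (zetaN N ^ k) / (2 * Real.pi * I) else 0) := by
    intro n hn
    rw [fTilde, HahnSeries.coeff_add, HahnSeries.coeff_add, HahnSeries.coeff_single,
      HahnSeries.coeff_single, PowerSeries.coeff_coe]
    have : (if n < 0 then 0 else PowerSeries.coeff n.natAbs (psiSeries k N)) = 0 := by
      split_ifs with h
      · rfl
      · obtain rfl : n = 0 := by omega
        simp [psiSeries]
    rw [this, add_zero]
    split_ifs <;> rfl
  rw [finsum_eq_sum_of_support_subset (s := {⟨0, le_rfl⟩, ⟨-1, by norm_num⟩})]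
  · rw [Finset.sum_pair (by simp), hcoeff 0 le_rfl, hcoeff (-1) (by norm_num)]
    simp
  · intro n hn
    rw [Function.mem_support, hcoeff n n.2] at hn
    by_contra h
    simp only [Finset.coe_insert, Finset.coe_singleton, mem_insert_iff, mem_singleton_iff,
      not_or, Subtype.ext_iff] at h
    simp [h.1, h.2] at hn

theorem re_exp_div_pos {θ : ℝ} {y : ℂ} (h : 0 < (exp (-(θ * I)) * y).re) :
    0 < (exp (θ * I) / y).re := by
  have h0 : exp (-(θ * I)) * y ≠ 0 := fun h' => by simp [h'] at h
  have : exp (θ * I) / y = (exp (-(θ * I)) * y)⁻¹ := by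
    rw [mul_inv, ← exp_neg, neg_neg, div_eq_mul_inv]
  rw [this, inv_re]
  exact div_pos h (normSq_pos.mpr h0)

theorem im_natCast_add_one_div_neg {y : ℂ} (hy : 0 < y.im) (j : ℕ) :
    (((j : ℂ) + 1) / y).im < 0 := by
  have hy0 : y ≠ 0 := by rintro rfl; simp at hy
  have : ((j : ℂ) + 1) / y = (((j : ℝ) + 1 : ℝ) : ℂ) * y⁻¹ := by push_cast; rw [div_eq_mul_inv]
  rw [this, im_ofReal_mul, inv_im, neg_div]
  have := div_pos hy (normSq_pos.mpr hy0)
  have : (0 : ℝ) < j + 1 := by positivity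
  nlinarith

section
variable {N k : ℕ}

theorem zetaN_pow_facts (hk : 1 ≤ k) (hkN : k < N) :
    (zetaN N ^ k) ^ N = 1 ∧ zetaN N ^ k ≠ 1 ∧ ‖zetaN N ^ k‖ = 1 ∧
      (zetaN N ^ k)⁻¹ = zetaN N ^ (N - k) := by
  have hζ := isPrimitiveRoot_zetaN (N := N) (by omega)
  have hωN : (zetaN N ^ k) ^ N = 1 := by
    rw [← pow_mul, mul_comm, pow_mul, hζ.pow_eq_one, one_pow]
  refine ⟨hωN, hζ.pow_ne_one_of_pos_of_lt (by omega) hkN,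
    Complex.norm_eq_one_of_pow_eq_one hωN (by omega), inv_eq_of_mul_eq_one_right ?_⟩
  rw [← pow_add, Nat.add_sub_cancel' hkN.le, hζ.pow_eq_one]

theorem hasBorelLaplaceSum_fTilde_of_cos_pos (hk : 1 ≤ k) (hkN : k < N) {θ : ℝ}
    (hθ : 0 < Real.cos θ) {y : ℂ} (hy : 0 < y.im) (hθy : 0 < (exp (-(θ * I)) * y).re) :
    HasBorelLaplaceSum (fTilde k N) θ y (fkN k N y - gkN (N - k) N (-1 / (N * y))) := by
  obtain ⟨hωN, hω, hω1, -⟩ := zetaN_pow_facts hk hkN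
  have hc : 0 < (exp (θ * I)).re := by rwa [exp_ofReal_mul_I_re]
  obtain ⟨hint, hsum⟩ := laplace_borelSum (by omega) hωN hω hω1 hc (re_exp_div_pos hθy)
  refine ⟨hθy, borelSum (zetaN N ^ k), isBorelContinuation_borelSum hω hω1 hθ.ne', hint, ?_⟩
  have hg := (hasSum_neg_gkN (N := N) (a := N - k) (b := k) (by omega) (by omega) hy).neg
  have huniq := (((hasSum_fkN_sub hk hkN hy).sub hsum).congr_fun fun j => ?_).unique hg
  · rw [finsum_fTilde]
    simp only [laplaceIntegrand]
    linear_combination huniq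
  · have h := one_div_add_blockLim_sub_blockLim hk hkN (im_natCast_add_one_div_neg hy j)
    rw [one_div_div] at h
    have hpi : (Real.pi : ℂ) ≠ 0 := by exact_mod_cast Real.pi_ne_zero
    have hI : I / (2 * Real.pi) * (2 * Real.pi * I) = -1 := by field_simp; rw [I_sq]
    linear_combination -(I / (2 * Real.pi) * (1 / ((j : ℂ) + 1))) * h -
      1 / ((j : ℂ) + 1) * (exp (2 * Real.pi * I * ((j + 1) / y / N)) ^ k /
          (exp (2 * Real.pi * I * ((j + 1) / y / N)) ^ N - 1)) * hI

/-- Since the Borel transform is even, ξ ↦ -ξ turns the integral into minus the one for -y along the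
opposite ray, which lies in the right half-plane. The expansion of f is still used at y, so now L(ω,
-j/y) cancels and the bilateral sum appears with ω⁻¹, that is, with N - k. -/
theorem hasBorelLaplaceSum_fTilde_of_cos_neg (hk : 1 ≤ k) (hkN : k < N) {θ : ℝ}
    (hθ : Real.cos θ < 0) {y : ℂ} (hy : 0 < y.im) (hθy : 0 < (exp (-(θ * I)) * y).re) :
    HasBorelLaplaceSum (fTilde k N) θ y (fkN k N y - gkN k N (-1 / (N * y))) := by
  obtain ⟨hωN, hω, hω1, hinv⟩ := zetaN_pow_facts hk hkN
  have hinv' : (zetaN N ^ (N - k))⁻¹ = zetaN N ^ k := by rw [← hinv, inv_inv]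
  have hc : 0 < (-exp (θ * I)).re := by rw [neg_re, exp_ofReal_mul_I_re]; linarith
  have hcy : 0 < (-exp (θ * I) / -y).re := by
    rw [neg_div_neg_eq]; exact re_exp_div_pos hθy
  obtain ⟨hint, hsum⟩ := laplace_borelSum (by omega) hωN hω hω1 hc hcy
  have hneg : ∀ t : ℝ, laplaceIntegrand (borelSum (zetaN N ^ k)) θ y t =
      -(exp (-(t * -exp (θ * I)) / -y) * borelSum (zetaN N ^ k) (t * -exp (θ * I)) *
        -exp (θ * I)) := fun t => by
    rw [laplaceIntegrand, mul_neg (t : ℂ), borelSum_neg, neg_div_neg_eq, mul_neg, neg_neg]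
  refine ⟨hθy, borelSum (zetaN N ^ k), isBorelContinuation_borelSum hω hω1 hθ.ne, ?_, ?_⟩
  · exact hint.neg.congr_fun (fun t _ => (hneg t).symm) measurableSet_Ioi
  have hg := (hasSum_neg_gkN (N := N) (a := k) (b := N - k) (by omega) (by omega) hy).neg
  have huniq := (((hasSum_fkN_sub hk hkN hy).add hsum).congr_fun fun j => ?_).unique hg
  · rw [finsum_fTilde]
    simp only [hneg, integral_neg]
    linear_combination huniq
  · have h := one_div_add_blockLim_sub_blockLim (N := N) (k := N - k) (by omega) (by omega)
      (im_natCast_add_one_div_neg hy j)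
    rw [one_div_div, hinv', ← hinv] at h
    have hpi : (Real.pi : ℂ) ≠ 0 := by exact_mod_cast Real.pi_ne_zero
    have hI : I / (2 * Real.pi) * (2 * Real.pi * I) = -1 := by field_simp; rw [I_sq]
    rw [div_neg, neg_div, neg_neg]
    linear_combination -(I / (2 * Real.pi) * (1 / ((j : ℂ) + 1))) * h -
      1 / ((j : ℂ) + 1) * (exp (2 * Real.pi * I * ((j + 1) / y / N)) ^ (N - k) /
          (exp (2 * Real.pi * I * ((j + 1) / y / N)) ^ N - 1)) * hI

theorem hasMedianSum_fTilde (hk : 1 ≤ k) (hkN : k < N) {y : ℂ} (hy : 0 < y.im) :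
    HasMedianSum (fTilde k N) (Real.pi / 2) y (fkN k N y -
      1 / 2 * (gkN k N (-1 / (N * y)) + gkN (N - k) N (-1 / (N * y)))) := by
  have hpi := Real.pi_pos
  have h0 : (exp (-((Real.pi / 2 : ℝ) * I)) * y).re = y.im := by
    have : exp (-((Real.pi / 2 : ℝ) * I)) = -I := by
      rw [exp_neg]; push_cast; rw [exp_pi_div_two_mul_I, inv_I]
    rw [this]; simp
  have hre : ∀ᶠ θ : ℝ in 𝓝 (Real.pi / 2), 0 < (exp (-(θ * I)) * y).re := by
    have hcont : Continuous fun θ : ℝ => (exp (-(θ * I)) * y).re := by fun_prop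
    exact hcont.continuousAt.eventually (lt_mem_nhds (hy.trans_eq h0.symm))
  have hadd : Tendsto (fun ε : ℝ => Real.pi / 2 + ε) (𝓝[>] 0) (𝓝 (Real.pi / 2)) := by
    have : Tendsto (fun ε : ℝ => Real.pi / 2 + ε) (𝓝 0) (𝓝 (Real.pi / 2 + 0)) :=
      Continuous.tendsto (by fun_prop) 0
    rw [add_zero] at this
    exact this.mono_left nhdsWithin_le_nhds
  have hsub : Tendsto (fun ε : ℝ => Real.pi / 2 - ε) (𝓝[>] 0) (𝓝 (Real.pi / 2)) := by
    have : Tendsto (fun ε : ℝ => Real.pi / 2 - ε) (𝓝 0) (𝓝 (Real.pi / 2 - 0)) :=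
      Continuous.tendsto (by fun_prop) 0
    rw [sub_zero] at this
    exact this.mono_left nhdsWithin_le_nhds
  -- For 0 < ε < π the cosine has constant sign on each side of π/2. The lateral sums are thus the
  -- left and right sums, with values independent of ε.
  have hsmall : ∀ᶠ ε : ℝ in 𝓝[>] 0, ε ∈ Ioo 0 Real.pi := Ioo_mem_nhdsGT hpi
  refine ⟨fkN k N y - gkN k N (-1 / (N * y)), fkN k N y - gkN (N - k) N (-1 / (N * y)), ?_, ?_,
    by ring⟩
  · filter_upwards [hadd.eventually hre, hsmall] with ε h1 h2
    exact hasBorelLaplaceSum_fTilde_of_cos_neg hk hkN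
      (Real.cos_neg_of_pi_div_two_lt_of_lt (by linarith [h2.1]) (by linarith [h2.2])) hy h1
  · filter_upwards [hsub.eventually hre, hsmall] with ε h1 h2
    exact hasBorelLaplaceSum_fTilde_of_cos_pos hk hkN
      (Real.cos_pos_of_mem_Ioo ⟨by linarith [h2.2], by linarith [h2.1]⟩) hy h1

end

/-- On the imaginary axis Q = e^{-2πt} lies in (0, 1), so every term of the Lambert series of -g is
positive. -/
theorem re_gkN_neg {a N : ℕ} (ha : 1 ≤ a) (hN : 1 ≤ N) {t : ℝ} (ht : 0 < t) :
    (gkN a N (t * I)).re < 0 := by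
  set Q := Real.exp (-(2 * Real.pi * t)) with hQ
  have hQ1 : Q < 1 := Real.exp_lt_one_iff.mpr (by have := Real.pi_pos; nlinarith [mul_pos this ht])
  have hQ0 : 0 < Q := Real.exp_pos _
  have hpow : ∀ n : ℕ, n ≠ 0 → Q ^ n < 1 := fun n hn => pow_lt_one₀ hQ0.le hQ1 hn
  have hexp : exp (2 * Real.pi * I * (t * I)) = (Q : ℂ) := by
    rw [hQ, ofReal_exp]
    congr 1
    push_cast
    linear_combination 2 * (Real.pi : ℂ) * t * I_sq
  have hn : ∀ n : ℕ, n ≠ 0 → ‖(Q : ℂ) ^ n‖ < 1 := fun n hn => by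
    rw [norm_pow, norm_real, Real.norm_of_nonneg hQ0.le]; exact hpow n hn
  have h := hasSum_neg_logQPochhammerInf (hn a (by omega)) (hn N (by omega))
  have hg : gkN a N (t * I) = logQPochhammerInf ((Q : ℂ) ^ a) ((Q : ℂ) ^ N) := by
    rw [gkN, hexp]
  have h2 : HasSum (fun j : ℕ => (Q ^ a) ^ (j + 1) / (((j : ℝ) + 1) * (1 - (Q ^ N) ^ (j + 1))))
      (-gkN a N (t * I)).re := by
    rw [hg]
    refine (hasSum_re h).congr_fun fun j => ?_
    rw [← ofReal_re (_ / _ : ℝ)]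
    congr 1
    push_cast
    rfl
  have hterm : ∀ j : ℕ, 0 < (Q ^ a) ^ (j + 1) / (((j : ℝ) + 1) * (1 - (Q ^ N) ^ (j + 1))) := by
    intro j
    have : 0 < 1 - (Q ^ N) ^ (j + 1) := by
      rw [← pow_mul]; exact sub_pos.mpr (hpow _ (by positivity))
    positivity
  have := h2.tsum_eq ▸ h2.summable.tsum_pos (fun j => (hterm j).le) 0 (hterm 0)
  rw [neg_re] at this
  linarith

theorem mainTheorem2 (N k : ℕ) (hN : 2 ≤ N) (hk : 1 ≤ k) (hkN : k < N) :
    (∀ y : ℂ, 0 < y.im → 0 < y.re →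
      HasBorelLaplaceSum (fTilde k N) 0 y (fkN k N y - gkN (N - k) N (-1 / (N * y)))) ∧
    (∀ y : ℂ, 0 < y.im → y.re < 0 →
      HasBorelLaplaceSum (fTilde k N) Real.pi y (fkN k N y - gkN k N (-1 / (N * y)))) ∧
    (∀ y : ℂ, 0 < y.im →
      HasMedianSum (fTilde k N) (Real.pi / 2) y
        (fkN k N y -
          1 / 2 * (gkN k N (-1 / (N * y)) + gkN (N - k) N (-1 / (N * y))))) ∧
    (∃ y : ℂ, 0 < y.im ∧ ¬ HasMedianSum (fTilde k N) (Real.pi / 2) y (fkN k N y)) := by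
  -- The witness y = i makes -1/(Ny) = i/N purely imaginary, where both g-terms have negative real
  -- part. By uniqueness of the median, recovering f would force their sum to vanish.
  refine ⟨fun y hy hre => ?_, fun y hy hre => ?_, fun y hy => hasMedianSum_fTilde hk hkN hy,
    I, by simp, fun h => ?_⟩
  · exact hasBorelLaplaceSum_fTilde_of_cos_pos hk hkN (by simp) hy (by simpa using hre)
  · refine hasBorelLaplaceSum_fTilde_of_cos_neg hk hkN (by simp) hy ?_
    rw [exp_neg, exp_pi_mul_I]
    simpa using hre
  · have heq := h.unique (hasMedianSum_fTilde hk hkN (by simp))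
    have hN0 : (N : ℂ) ≠ 0 := by exact_mod_cast (show N ≠ 0 by omega)
    have hτ : -1 / (N * I) = ((N : ℝ)⁻¹ : ℝ) * I := by
      push_cast
      field_simp
      rw [I_sq]
    rw [hτ] at heq
    have hpos : (0 : ℝ) < (N : ℝ)⁻¹ := by positivity
    have h1 := re_gkN_neg hk (show 1 ≤ N by omega) hpos
    have h2 := re_gkN_neg (show 1 ≤ N - k by omega) (show 1 ≤ N by omega) hpos
    have h3 : gkN k N (((N : ℝ)⁻¹ : ℝ) * I) + gkN (N - k) N (((N : ℝ)⁻¹ : ℝ) * I) = 0 := by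
      linear_combination 2 * heq
    have h4 := congrArg re h3
    rw [add_re, zero_re] at h4
    linarith

end
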